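/- Let $G=(V,E,w)$ be a finite simple digraph (no self-loops; opposite edges are allowed) with positive edge weights. Let $d(i,j)\in[0,\infty]$ be the minimal length of a directed path from $i$ to $j$ ($\infty$ if there is none), and for $t\in\mathbb R$ let $G^t$ be the digraph on $V$ with an edge $(i,j)$ whenever $i\ne j$ and $d(i,j)\le t$. For a digraph $K$ let $\Omega_\bullet(K)$ be the regular path chain complex of $K$ with coefficients in $\mathbb R$ (allowed paths whose regular boundary is allowed). Consider two persistent vector spaces, with structure maps induced by inclusion: * the standard pipeline $\mathcal H_1(G)$, $t\mapsto H_1(\Omega_\bullet(G^t))$; * grounded persistent path homology $\mathcal H^{\mathrm{gr}}_1(G)$, which for $t\ge 0$ is the degree-one homology of $\Omega_2(G^t)\to\Omega_1(G\cup G^t)\to\Omega_0(G\cup G^t)$ and which is $0$ for $t<0$. Let $G_0=G$, and let $G_{n+1}$ be the medial subdivision of $G_n$: every edge $e=(a,b)$ is replaced by two edges $(a,m_e)$ and $(m_e,b)$ through a new vertex $m_e$, each of weight $w(e)/2$. **Theorem.** For every $n$, $\mathcal H^{\mathrm{gr}}_1(G_n)$ and $\mathcal H_1(G_n)$ have finite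 barcodes (that is, each is isomorphic to a finite direct sum of interval modules), and as $n\to\infty$ the two sequences of barcodes converge in the bottleneck distance to one and the same barcode: $$\lim_{n\to\infty}\operatorname{Barcode}\big(\mathcal H^{\mathrm{gr}}_1(G_n)\big)=\lim_{n\to\infty}\operatorname{Barcode}\big(\mathcal H_1(G_n)\big).$$ -/

import Mathlib

open CategoryTheory Filter Topology
open scoped ENNReal

namespace GrPPH

noncomputable section

/-! ### Weighted digraphs -/

/-- A weighted (simple) digraph: a finite vertex set, a set of directed edges without self-loops,
and a positive weight on every edge (the values of `w` at pairs that are not edges play no role). -/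
structure WDigraph where
  /-- The vertex set. -/
  V : Type
  [finV : Finite V]
  /-- The underlying digraph. -/
  graph : Digraph V
  loopless : ∀ a, ¬ graph.Adj a a
  /-- The edge weights. -/
  w : V → V → ℝ
  w_pos : ∀ a b, graph.Adj a b → 0 < w a b

attribute [instance] WDigraph.finV

namespace WDigraph

variable (G : WDigraph)

/-- The list `l` of vertices is a directed path (no repeated vertices) from `a` to `b` in `G`.
The one-vertex list is the path with no edges from a vertex to itself. -/
def IsPath (a b : G.V) (l : List G.V) : Prop :=
  l.IsChain G.graph.Adj ∧ l.Nodup ∧ l.head? = some a ∧ l.getLast? = some b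

/-- The length of a path, i.e. the sum of the weights of its edges. -/
def pathLength : List G.V → ℝ
  | [] => 0
  | [_] => 0
  | a :: b :: l => G.w a b + pathLength (b :: l)

/-- The shortest-path quasimetric, with value `⊤` if there is no path. -/
def dist (a b : G.V) : EReal :=
  ⨅ (l : List G.V) (_ : G.IsPath a b l), (G.pathLength l : EReal)

/-- The digraph `G^t` of the shortest-path filtration. -/
def shortestPath (t : ℝ) : Digraph G.V where
  Adj a b := a ≠ b ∧ G.dist a b ≤ (t : EReal)

/-- The digraph in which the one-chains of the grounded complex live: it is `G ∪ G^t` for `t ≥ 0`.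
The grounded filtration starts at time `0`: there are no edges at negative times. -/
def grounded (t : ℝ) : Digraph G.V where
  Adj a b := (0 ≤ t ∧ G.graph.Adj a b) ∨ (G.shortestPath t).Adj a b

theorem shortestPath_mono : Monotone G.shortestPath := fun _ _ hst _ _ h =>
  ⟨h.1, h.2.trans (EReal.coe_le_coe_iff.2 hst)⟩

theorem grounded_mono : Monotone G.grounded := fun _ _ hst _ _ h =>
  h.imp (fun h' => ⟨h'.1.trans hst, h'.2⟩) (fun h' => G.shortestPath_mono hst h')

/-- The medial subdivision: every edge `e = (a, b)` is replaced by two edges `(a, m_e)`, `(m_e, b)`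
through a new vertex `m_e`, each of weight `w e / 2`. -/
def medial : WDigraph where
  V := G.V ⊕ {e : G.V × G.V // G.graph.Adj e.1 e.2}
  graph :=
    { Adj := fun x y => match x, y with
        | Sum.inl a, Sum.inr e => a = e.1.1
        | Sum.inr e, Sum.inl b => b = e.1.2
        | _, _ => False }
  loopless := by rintro (a | e) h <;> exact h
  w := fun x y => match x, y with
    | Sum.inl _, Sum.inr e => G.w e.1.1 e.1.2 / 2
    | Sum.inr e, Sum.inl _ => G.w e.1.1 e.1.2 / 2
    | _, _ => 0
  w_pos := by
    rintro (a | e) (b | e') h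
    · exact h.elim
    · exact half_pos (G.w_pos _ _ e'.2)
    · exact half_pos (G.w_pos _ _ e.2)
    · exact h.elim

/-- The `n`-th iterated medial subdivision. -/
def iteratedMedial : ℕ → WDigraph
  | 0 => G
  | n + 1 => (iteratedMedial n).medial

end WDigraph

/-! ### The regular path complex, over `ℝ` -/

section PathComplex

variable {V : Type}

/-- The space `Λ_p` of real combinations of elementary `p`-paths `v_0 … v_p` on `V`. -/
abbrev Chains (V : Type) (p : ℕ) : Type := (Fin (p + 1) → V) →₀ ℝ

/-- An elementary path is regular if consecutive vertices are distinct. -/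
def IsRegular {p : ℕ} (v : Fin (p + 1) → V) : Prop :=
  ∀ i : Fin p, v i.castSucc ≠ v i.succ

/-- An elementary path is allowed if consecutive vertices are joined by an edge. -/
def IsAllowed (K : Digraph V) {p : ℕ} (v : Fin (p + 1) → V) : Prop :=
  ∀ i : Fin p, K.Adj (v i.castSucc) (v i.succ)

open scoped Classical in
/-- The regular boundary map: the alternating sum of the faces, non-regular faces being `0`. -/
def boundary (V : Type) (p : ℕ) : Chains V (p + 1) →ₗ[ℝ] Chains V p :=
  Finsupp.linearCombination ℝ fun v : Fin (p + 2) → V =>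
    ∑ i : Fin (p + 2), (-1 : ℝ) ^ (i : ℕ) •
      (if IsRegular (v ∘ i.succAbove) then Finsupp.single (v ∘ i.succAbove) (1 : ℝ) else 0)

/-- The space `A_p` spanned by the allowed `p`-paths. -/
def allowed (K : Digraph V) (p : ℕ) : Submodule ℝ (Chains V p) :=
  Finsupp.supported ℝ ℝ {v | IsAllowed K v}

/-- The space `Ω_p` of `∂`-invariant `p`-paths: allowed chains whose boundary is allowed. -/
def invariantPaths (K : Digraph V) : (p : ℕ) → Submodule ℝ (Chains V p)
  | 0 => allowed K 0
  | p + 1 => allowed K (p + 1) ⊓ (allowed K p).comap (boundary V p)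

theorem allowed_mono {K L : Digraph V} (h : K ≤ L) (p : ℕ) : allowed K p ≤ allowed L p :=
  Finsupp.supported_mono fun _ hv i => h (hv i)

theorem invariantPaths_mono {K L : Digraph V} (h : K ≤ L) :
    ∀ p : ℕ, invariantPaths K p ≤ invariantPaths L p
  | 0 => allowed_mono h 0
  | p + 1 => inf_le_inf (allowed_mono h _) (Submodule.comap_mono (allowed_mono h _))

/-- The one-cycles `ker (∂ : Ω_1 L → Ω_0 L)`. -/
def cycles (L : Digraph V) : Submodule ℝ (Chains V 1) :=
  invariantPaths L 1 ⊓ LinearMap.ker (boundary V 0)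

/-- The one-boundaries `im (∂ : Ω_2 K → Λ_1)`. -/
def boundaries (K : Digraph V) : Submodule ℝ (Chains V 1) :=
  (invariantPaths K 2).map (boundary V 1)

theorem cycles_mono {K L : Digraph V} (h : K ≤ L) : cycles K ≤ cycles L :=
  inf_le_inf_right _ (invariantPaths_mono h 1)

theorem boundaries_mono {K L : Digraph V} (h : K ≤ L) : boundaries K ≤ boundaries L :=
  Submodule.map_mono (invariantPaths_mono h 2)

end PathComplex

/-! ### Persistent vector spaces -/

/-- Persistent (real) vector spaces: functors from the poset `(ℝ, ≤)`. -/
abbrev PersVec := ℝ ⥤ ModuleCat.{0} ℝ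

/-- The persistent vector space `t ↦ Z t / (B t ∩ Z t)` of two increasing families of subspaces, with
the maps induced by the inclusions. -/
def subquotient {M : Type} [AddCommGroup M] [Module ℝ M] (Z B : ℝ → Submodule ℝ M)
    (hZ : Monotone Z) (hB : Monotone B) : PersVec where
  obj t := ModuleCat.of ℝ (Z t ⧸ (B t).submoduleOf (Z t))
  map {s t} f := ModuleCat.ofHom
    (Submodule.mapQ ((B s).submoduleOf (Z s)) ((B t).submoduleOf (Z t))
      (Submodule.inclusion (hZ (leOfHom f))) fun _ hx => hB (leOfHom f) hx)
  map_id t := by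
    ext x
    rfl
  map_comp f g := by
    ext x
    rfl

/-- For filtrations `K t ⊆ L t` of digraphs, the degree one homology (cycles modulo boundaries) of
the complexes `Ω_2 (K t) → Ω_1 (L t) → Ω_0 (L t)`, with the maps induced by the inclusions. -/
def persistentH1 {V : Type} (K L : ℝ → Digraph V) (hK : Monotone K) (hL : Monotone L) :
    PersVec :=
  subquotient (fun t => cycles (L t)) (fun t => boundaries (K t))
    (fun _ _ h => cycles_mono (hL h)) (fun _ _ h => boundaries_mono (hK h))

/-- The standard pipeline in degree one: persistent regular path homology of the shortest-path
filtration. -/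
def standardPH (G : WDigraph) : PersVec :=
  persistentH1 G.shortestPath G.shortestPath G.shortestPath_mono G.shortestPath_mono

/-- Grounded persistent path homology: the degree one homology of
`Ω_2 (G^t) → Ω_1 (G ∪ G^t) → Ω_0 (G ∪ G^t)`. -/
def groundedPH (G : WDigraph) : PersVec :=
  persistentH1 G.shortestPath G.grounded G.shortestPath_mono G.grounded_mono

/-! ### Barcodes -/

/-- A nonempty interval of `ℝ` of any kind: open, closed or half-open, bounded or not. -/
structure RInterval where
  /-- The underlying set. -/
  carrier : Set ℝ
  nonempty : carrier.Nonempty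
  ordConnected : carrier.OrdConnected

/-- The value at `t` of the interval module of `I`: all of `ℝ` if `t ∈ I`, and `0` otherwise. -/
def RInterval.fiber (I : RInterval) (t : ℝ) : Submodule ℝ ℝ where
  carrier := {x | t ∉ I.carrier → x = 0}
  zero_mem' := fun _ => rfl
  add_mem' := fun hx hy ht => by rw [hx ht, hy ht, add_zero]
  smul_mem' := fun c x hx ht => by rw [hx ht, smul_zero]

open scoped Classical in
/-- The transition map of the interval module: the identity if `s, t ∈ I`, and `0` otherwise
(the source is `0` if `s ∉ I`). -/
def RInterval.fiberMap (I : RInterval) (s t : ℝ) : I.fiber s →ₗ[ℝ] I.fiber t where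
  toFun x := ⟨if t ∈ I.carrier then x.1 else 0, fun ht => if_neg ht⟩
  map_add' x y := by
    ext
    by_cases ht : t ∈ I.carrier <;> simp [ht]
  map_smul' c x := by
    ext
    by_cases ht : t ∈ I.carrier <;> simp [ht]

/-- The interval module `P(I)`. -/
def intervalModule (I : RInterval) : PersVec where
  obj t := ModuleCat.of ℝ (I.fiber t)
  map {s t} _ := ModuleCat.ofHom (I.fiberMap s t)
  map_id t := by
    ext x
    by_cases ht : t ∈ I.carrier
    · simp [RInterval.fiberMap, ht]
    · simp [RInterval.fiberMap, ht, x.2 ht]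
  map_comp {r s t} f g := by
    ext x
    by_cases ht : t ∈ I.carrier
    · by_cases hs : s ∈ I.carrier
      · simp [RInterval.fiberMap, ht, hs]
      · have hr : r ∉ I.carrier := fun hr =>
          hs (I.ordConnected.out hr ht ⟨leOfHom f, leOfHom g⟩)
        simp [RInterval.fiberMap, ht, hs, x.2 hr]
    · simp [RInterval.fiberMap, ht]

/-- The direct sum of a finite family of persistent vector spaces, formed pointwise. -/
def directSum {ι : Type} [Finite ι] (N : ι → PersVec) : PersVec where
  obj t := ModuleCat.of ℝ (∀ i, (N i).obj t)
  map f := ModuleCat.ofHom (LinearMap.pi fun i => ((N i).map f).hom ∘ₗ LinearMap.proj i)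
  map_id t := by
    ext x i
    simp
  map_comp f g := by
    ext x i
    simp

/-- A barcode: a finite multiset of intervals, written as a finite family. -/
structure Barcode where
  /-- The index set of the features. -/
  ι : Type
  [finι : Finite ι]
  /-- The interval of a feature. -/
  bar : ι → RInterval

attribute [instance] Barcode.finι

/-- `B` is the barcode of `M`: `M` is isomorphic to the direct sum of the interval modules of the
intervals in `B`. -/
def IsBarcode (M : PersVec) (B : Barcode) : Prop :=
  Nonempty (M ≅ directSum fun i => intervalModule (B.bar i))

/-- The birth time, i.e. the left endpoint. -/
def RInterval.birth (I : RInterval) : EReal := sInf ((fun x : ℝ => (x : EReal)) '' I.carrier)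

/-- The death time, i.e. the right endpoint. -/
def RInterval.death (I : RInterval) : EReal := sSup ((fun x : ℝ => (x : EReal)) '' I.carrier)

open scoped Classical in
/-- The distance of two extended real numbers: `|x - y|` if both are real, and otherwise `0` if
`x = y` and `∞` if not. -/
def extDist (x y : EReal) : ℝ≥0∞ := if x = y then 0 else (x - y).abs

/-- The distance in the sup norm of the points of two intervals in the persistence diagram. -/
def RInterval.pointDist (I J : RInterval) : ℝ≥0∞ :=
  max (extDist I.birth J.birth) (extDist I.death J.death)

/-- The distance in the sup norm of the point of an interval in the persistence diagram to the
diagonal. -/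
def RInterval.diagDist (I : RInterval) : ℝ≥0∞ :=
  ⨅ x : ℝ, max (extDist I.birth x) (extDist I.death x)

/-- The cost of a partial matching of two barcodes: the largest distance between matched points,
or of an unmatched point to the diagonal. -/
def matchingCost (B C : Barcode) (σ : B.ι ≃. C.ι) : ℝ≥0∞ :=
  (⨆ (i : B.ι) (j : C.ι) (_ : σ i = some j), (B.bar i).pointDist (C.bar j)) ⊔
    ((⨆ (i : B.ι) (_ : σ i = none), (B.bar i).diagDist) ⊔
      (⨆ (j : C.ι) (_ : σ.symm j = none), (C.bar j).diagDist))

/-- The bottleneck distance: the infimum of the costs of all partial matchings, unmatched points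
being matched to the diagonal. -/
def bottleneckDist (B C : Barcode) : ℝ≥0∞ := ⨅ σ : B.ι ≃. C.ι, matchingCost B C σ

/-- The persistent vector spaces `M 0, M 1, …` all have a barcode, and their barcodes converge to
the barcode `L` in the bottleneck distance. -/
def BarcodesTendsto (M : ℕ → PersVec) (L : Barcode) : Prop :=
  (∀ n, ∃ B, IsBarcode (M n) B) ∧
    ∀ B : ℕ → Barcode, (∀ n, IsBarcode (M n) (B n)) →
      Tendsto (fun n => bottleneckDist (B n) L) atTop (𝓝 0)

end

end GrPPH

namespace GrPPH

noncomputable section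

/-! Let `T` bound the edge weights of `G`. From time `T` on, `G` is contained in `G^t`, so both
pipelines take the same value, and filling in triangles along walks makes every cycle of `G^t`
homologous to a cycle of `G` (`cycles_shortestPath`). The common value is thus the fixed space of
cycles of `G`, of dimension `N`, modulo an increasing family of subspaces of dimension `nullRank t`.
Hence every bar that reaches beyond `T` already contains `T`, the deaths after `T` can be read off
`nullRank`, and the remaining bars lie in `[0, T]`, close to the diagonal.

Subdivision keeps `N` and changes `nullRank` only by a time shift. On cycles, `subdivide` and the
push-forward along `collapse` are mutually inverse, and both send null cycles to null cycles after a
delay bounded by the largest weight (`nullRank_le_medial`, `nullRank_medial_le`). At level `n` this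
delay is `W / 2^n`; the delays from level `n` on sum to `2 * (W / 2^n)`. Up to vanishing shifts the
ranks therefore converge to one function, `limitRank`, and its `quotientBarcode` is the limit of
both sequences: `bottleneckDist_quotientBarcode_le` turns a shift `δ` of ranks into a matching of
cost at most `T + δ`.

That barcodes exist is a separate matter: two chains of subspaces have a common adapted basis
(`exists_adapted_set`), whose vectors are the generators of the bars. -/

open scoped Classical in
theorem RInterval.fiberMap_apply (I : RInterval) (s t : ℝ) (x : I.fiber s) :
    (I.fiberMap s t x : ℝ) = if t ∈ I.carrier then (x : ℝ) else 0 := rfl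

/-! ### Interval decomposition of subquotients of a finite-dimensional space -/

section Adapted

variable {E : Type} [AddCommGroup E] [Module ℝ E] [FiniteDimensional ℝ E]

/-- A coatom below `W` that contains all the proper members of the chain `Z t ⊓ W`. -/
theorem exists_covBy_of_monotone {Z : ℝ → Submodule ℝ E} (hZ : Monotone Z) {W : Submodule ℝ E}
    (hW : W ≠ ⊥) : ∃ H, H ⋖ W ∧ ∀ t, W ≤ Z t ∨ Z t ⊓ W ≤ H := by
  -- `⊥` is included so that a largest proper member exists even when no `Z t ⊓ W` is proper.
  let S : Set (Submodule ℝ E) := {X | X < W ∧ (X = ⊥ ∨ ∃ t, X = Z t ⊓ W)}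
  obtain ⟨X, ⟨hXW, hX⟩, hmax⟩ := wellFounded_gt.has_min S ⟨⊥, bot_lt_iff_ne_bot.2 hW, Or.inl rfl⟩
  obtain ⟨H, hXH, hH⟩ := exists_le_covBy_of_lt hXW
  refine ⟨H, hH, fun t => or_iff_not_imp_left.2 fun ht => ?_⟩
  refine le_trans ?_ hXH
  have hlt : Z t ⊓ W < W := lt_of_le_of_ne inf_le_right fun h => ht (inf_eq_right.1 h)
  have hn := hmax _ ⟨hlt, Or.inr ⟨t, rfl⟩⟩
  rcases hX with rfl | ⟨s, rfl⟩
  · by_contra h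
    exact hn (bot_lt_iff_ne_bot.2 fun h' => h h'.le)
  · rcases le_total s t with h | h
    · have h1 : Z s ⊓ W ≤ Z t ⊓ W := inf_le_inf_right _ (hZ h)
      by_contra h2
      exact hn (lt_of_le_not_ge h1 h2)
    · exact inf_le_inf_right _ (hZ h)

/-- A vector of `W` outside `H` that lies in all the members of a chain that meet `W` outside `H`. -/
theorem exists_mem_of_monotone {B : ℝ → Submodule ℝ E} (hB : Monotone B) {H W : Submodule ℝ E}
    (hHW : H < W) : ∃ v ∈ W, v ∉ H ∧ ∀ t, B t ⊓ W ≤ H ∨ v ∈ B t := by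
  by_cases h : ∃ t, ¬ B t ⊓ W ≤ H
  · let S : Set (Submodule ℝ E) := {X | ¬ X ≤ H ∧ ∃ t, X = B t ⊓ W}
    obtain ⟨X, ⟨hX, s, rfl⟩, hmin⟩ :=
      wellFounded_lt.has_min S (h.elim fun t ht => ⟨_, ht, t, rfl⟩)
    obtain ⟨v, hv, hvH⟩ := SetLike.not_le_iff_exists.1 hX
    refine ⟨v, hv.2, hvH, fun t => or_iff_not_imp_left.2 fun ht => ?_⟩
    have hn := hmin _ ⟨ht, t, rfl⟩
    rcases le_total s t with h | h
    · exact hB h hv.1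
    · have h1 : B t ⊓ W ≤ B s ⊓ W := inf_le_inf_right _ (hB h)
      have h2 : B s ⊓ W ≤ B t ⊓ W := by
        by_contra h2
        exact hn (lt_of_le_not_ge h1 h2)
      exact (h2 hv).1
  · push Not at h
    obtain ⟨v, hv, hvH⟩ := SetLike.exists_of_lt hHW
    exact ⟨v, hv, hvH, fun t => Or.inl (h t)⟩

/-- Two chains of subspaces of a finite dimensional space have a common adapted basis. -/
theorem exists_adapted_set {Z B : ℝ → Submodule ℝ E} (hZ : Monotone Z) (hB : Monotone B)
    (W : Submodule ℝ E) :
    ∃ S : Set E, LinearIndepOn ℝ id S ∧ Submodule.span ℝ S = W ∧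
      (∀ t, Z t ⊓ W = Submodule.span ℝ (S ∩ Z t)) ∧
      (∀ t, B t ⊓ W = Submodule.span ℝ (S ∩ B t)) := by
  induction W using WellFoundedLT.induction with
  | ind W ih =>
  by_cases hW : W = ⊥
  · subst hW
    exact ⟨∅, linearIndepOn_empty ℝ id, by simp, by simp, by simp⟩
  obtain ⟨H, hH, hZH⟩ := exists_covBy_of_monotone hZ hW
  -- An adapted basis of `H` extends by `v`: the choice of `H` takes care of the chain `Z`, the
  -- choice of `v` of the chain `B`.
  obtain ⟨v, hvW, hvH, hvB⟩ := exists_mem_of_monotone hB hH.lt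
  obtain ⟨S, hS, hSH, hSZ, hSB⟩ := ih H hH.lt
  have hspan : Submodule.span ℝ (insert v S) = W := by
    rw [Submodule.span_insert, hSH]
    refine (hH.eq_or_eq le_sup_right (sup_le ?_ hH.le)).resolve_left fun h => hvH ?_
    · simpa using hvW
    · simpa using sup_eq_right.1 h
  have key : ∀ X : Submodule ℝ E, X ⊓ W ≤ H → X ⊓ H = Submodule.span ℝ (S ∩ X) →
      X ⊓ W = Submodule.span ℝ (insert v S ∩ X) := by
    intro X h1 h2
    have hv : v ∉ (X : Set E) := fun hv => hvH (h1 ⟨hv, hvW⟩)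
    rw [Set.insert_inter_of_notMem hv, ← h2]
    exact le_antisymm (le_inf inf_le_left h1) (inf_le_inf_left _ hH.le)
  refine ⟨insert v S, ?_, hspan, fun t => ?_, fun t => ?_⟩
  · refine hS.insert ?_
    simpa [hSH] using hvH
  · rcases hZH t with h | h
    · rw [inf_eq_right.2 h, Set.inter_eq_left.2, hspan]
      exact Submodule.subset_span.trans (hspan.le.trans h)
    · exact key _ h (hSZ t)
  · rcases hvB t with h | h
    · exact key _ h (hSB t)
    -- The modular law: `B t ⊓ (span {v} ⊔ H) = span {v} ⊔ (B t ⊓ H)`, because `v ∈ B t`.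
    · rw [Set.insert_inter_of_mem h, Submodule.span_insert, ← hSB t, ← hspan,
        Submodule.span_insert, hSH, inf_comm, sup_inf_assoc_of_le, inf_comm]
      simpa using h

theorem exists_adapted_basis {Z B : ℝ → Submodule ℝ E} (hZ : Monotone Z) (hB : Monotone B) :
    ∃ (S : Set E) (b : Module.Basis S ℝ E),
      (∀ t x, x ∈ Z t ↔ ∀ i, b.repr x i ≠ 0 → b i ∈ Z t) ∧
      (∀ t x, x ∈ B t ↔ ∀ i, b.repr x i ≠ 0 → b i ∈ B t) := by
  obtain ⟨S, hS, hspan, hSZ, hSB⟩ := exists_adapted_set hZ hB ⊤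
  let b : Module.Basis S ℝ E := Module.Basis.mk hS (by simp [hspan])
  have hb : ∀ i : S, b i = i := fun i => by simp [b]
  have key : ∀ X : Submodule ℝ E, X ⊓ ⊤ = Submodule.span ℝ (S ∩ X) →
      ∀ x, x ∈ X ↔ ∀ i, b.repr x i ≠ 0 → b i ∈ X := by
    intro X hX x
    have himg : S ∩ X = b '' {i | b i ∈ X} := by
      ext y
      simp only [hb, Set.mem_inter_iff, Set.mem_image, Set.mem_ofPred_eq, SetLike.mem_coe]
      exact ⟨fun h => ⟨⟨y, h.1⟩, h.2, rfl⟩, by rintro ⟨i, hi, rfl⟩; exact ⟨i.2, hi⟩⟩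
    rw [inf_top_eq, himg] at hX
    conv_lhs => rw [hX, b.mem_span_image]
    simp [Set.subset_def]
  exact ⟨S, b, fun t => key _ (hSZ t), fun t => key _ (hSB t)⟩

open scoped Classical in
/-- A subquotient of a finite dimensional space has a barcode. -/
theorem exists_isBarcode_subquotient {Z B : ℝ → Submodule ℝ E} (hZ : Monotone Z)
    (hB : Monotone B) : ∃ C, IsBarcode (subquotient Z B hZ hB) C := by
  obtain ⟨S, b, hbZ, hbB⟩ := exists_adapted_basis hZ hB
  have : Finite S := Module.Finite.finite_basis b
  have : Fintype S := Fintype.ofFinite S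
  -- A basis vector lives from its entry into `Z` until its entry into `B`; vectors that are never
  -- alive are dropped, since bars are nonempty.
  let I : S → Set ℝ := fun i => {t | b i ∈ Z t ∧ b i ∉ B t}
  let C : Barcode :=
    { ι := {i : S // (I i).Nonempty}
      bar := fun i =>
        { carrier := I i
          nonempty := i.2
          ordConnected := ⟨fun s hs t ht u hu => ⟨hZ hu.1 hs.1, fun h => ht.2 (hB hu.2 h)⟩⟩ } }
  let φ : ∀ t, Z t →ₗ[ℝ] ∀ i : C.ι, (C.bar i).fiber t := fun t =>
    LinearMap.pi fun i =>
      { toFun := fun z => ⟨if t ∈ I i.1 then b.repr z i.1 else 0, fun h => if_neg h⟩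
        map_add' := fun x y => by ext; by_cases h : t ∈ I i.1 <;> simp [h]
        map_smul' := fun c x => by ext; by_cases h : t ∈ I i.1 <;> simp [h] }
  have hφ : ∀ t z i, (φ t z i : ℝ) = if t ∈ I i.1 then b.repr z i.1 else 0 := fun _ _ _ => rfl
  have hker : ∀ t, LinearMap.ker (φ t) = (B t).submoduleOf (Z t) := by
    intro t
    ext z
    rw [LinearMap.mem_ker]
    change _ ↔ (z : E) ∈ B t
    rw [hbB]
    constructor
    · intro h i hi
      by_contra hc
      have hI : t ∈ I i := ⟨(hbZ t z).1 z.2 i hi, hc⟩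
      have := congrArg Subtype.val (congrFun h ⟨i, t, hI⟩)
      rw [hφ, if_pos hI] at this
      exact hi this
    · intro h
      ext i
      rw [hφ]
      split_ifs with hI
      · by_contra hc
        exact hI.2 (h _ hc)
      · rfl
  have hsurj : ∀ t, Function.Surjective (φ t) := by
    intro t y
    let x : E := ∑ i : C.ι, (y i : ℝ) • b i.1
    have hx : ∀ i, b.repr x i.1 = y i := by
      intro i
      simp only [x, map_sum, map_smul, Module.Basis.repr_self, Finsupp.smul_single, smul_eq_mul,
        mul_one, Finsupp.finsetSum_apply, Finsupp.single_apply]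
      rw [Finset.sum_eq_single i]
      · simp
      · intro j _ hj
        rw [if_neg fun h => hj (Subtype.ext h)]
      · simp
    have hxZ : x ∈ Z t := by
      refine Submodule.sum_mem _ fun i _ => ?_
      by_cases h : t ∈ I i.1
      · exact Submodule.smul_mem _ _ h.1
      · rw [show (y i : ℝ) = 0 from (y i).2 h, zero_smul]
        exact zero_mem _
    refine ⟨⟨x, hxZ⟩, ?_⟩
    ext i
    rw [hφ]
    split_ifs with h
    · exact hx i
    · exact ((y i).2 h).symm
  let e : ∀ t, (Z t ⧸ (B t).submoduleOf (Z t)) ≃ₗ[ℝ] ∀ i : C.ι, (C.bar i).fiber t := fun t =>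
    (Submodule.quotEquivOfEq _ _ (hker t).symm).trans
      ((φ t).quotKerEquivOfSurjective (hsurj t))
  have he : ∀ t z, e t (Submodule.Quotient.mk z) = φ t z := fun _ _ => rfl
  refine ⟨C, ⟨NatIso.ofComponents (fun t => (e t).toModuleIso) fun {s t} f => ?_⟩⟩
  ext x
  obtain ⟨z, rfl⟩ := Submodule.Quotient.mk_surjective _ x
  change φ t (Submodule.inclusion (hZ (leOfHom f)) z) =
    fun i => (C.bar i).fiberMap s t (φ s z i)
  ext i
  rw [RInterval.fiberMap_apply, hφ, hφ]
  by_cases ht : t ∈ I i.1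
  · have ht' : t ∈ (C.bar i).carrier := ht
    rw [if_pos ht, if_pos ht']
    split_ifs with hs
    · rfl
    -- A nonzero coordinate puts `b i` into `Z s`, and `b i ∉ B t` excludes it from `B s`; so `s`
    -- would lie in the bar.
    · by_contra hc
      exact hs ⟨(hbZ s z).1 z.2 _ hc, fun h => ht.2 (hB (leOfHom f) h)⟩
  · have ht' : t ∉ (C.bar i).carrier := ht
    rw [if_neg ht, if_neg ht']

end Adapted

/-! ### Matchings of barcodes -/

/-- With `⊥` excluded, the two one-sided bounds force both endpoints to be `⊤` as soon as one is,
and the distance is then `0` by convention. -/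
theorem extDist_le {x y : EReal} {c : ℝ} (hx : x ≠ ⊥) (hy : y ≠ ⊥) (hxy : x ≤ y + c)
    (hyx : y ≤ x + c) : extDist x y ≤ ENNReal.ofReal c := by
  unfold extDist
  split_ifs with h
  · exact zero_le
  induction x with
  | bot => exact absurd rfl hx
  | top =>
    induction y with
    | bot => exact absurd rfl hy
    | top => exact absurd rfl h
    | coe y => exact absurd hxy (by rw [← EReal.coe_add]; exact not_le.2 (EReal.coe_lt_top _))
  | coe x =>
    induction y with
    | bot => exact absurd rfl hy
    | top => exact absurd hyx (by rw [← EReal.coe_add]; exact not_le.2 (EReal.coe_lt_top _))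
    | coe y =>
      rw [← EReal.coe_add, EReal.coe_le_coe_iff] at hxy hyx
      rw [← EReal.coe_sub, EReal.abs_def]
      exact ENNReal.ofReal_le_ofReal (abs_le.2 ⟨by linarith, by linarith⟩)

theorem extDist_coe_le {x : EReal} {a b c : ℝ} (ha : (a : EReal) ≤ x) (hb : x ≤ (b : EReal))
    {y : ℝ} (hy : y ≤ a + c) (hy' : b ≤ y + c) : extDist x y ≤ ENNReal.ofReal c := by
  refine extDist_le (fun h => ?_) (EReal.coe_ne_bot y) ?_ ?_
  · rw [h] at ha
    exact absurd ha (by simp)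
  · rw [← EReal.coe_add]
    exact hb.trans (EReal.coe_le_coe_iff.2 hy')
  · refine le_trans ?_ (add_le_add_left ha _)
    rw [← EReal.coe_add]
    exact EReal.coe_le_coe_iff.2 hy

namespace RInterval

variable (I : RInterval)

theorem birth_le {t : ℝ} (ht : t ∈ I.carrier) : I.birth ≤ t := sInf_le ⟨t, ht, rfl⟩

theorem le_death {t : ℝ} (ht : t ∈ I.carrier) : (t : EReal) ≤ I.death := le_sSup ⟨t, ht, rfl⟩

theorem le_birth {a : ℝ} (h : ∀ t ∈ I.carrier, a ≤ t) : (a : EReal) ≤ I.birth := by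
  refine le_sInf ?_
  rintro _ ⟨t, ht, rfl⟩
  exact EReal.coe_le_coe_iff.2 (h t ht)

theorem death_le {a : ℝ} (h : ∀ t ∈ I.carrier, t ≤ a) : I.death ≤ a := by
  refine sSup_le ?_
  rintro _ ⟨t, ht, rfl⟩
  exact EReal.coe_le_coe_iff.2 (h t ht)

theorem exists_mem_gt {t : ℝ} (h : (t : EReal) < I.death) : ∃ s ∈ I.carrier, t < s := by
  obtain ⟨_, ⟨s, hs, rfl⟩, hts⟩ := lt_sSup_iff.1 h
  exact ⟨s, hs, EReal.coe_lt_coe_iff.1 hts⟩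

/-- An interval inside `[0, a]` is within `a` of the diagonal. -/
theorem diagDist_le {a c : ℝ} (h0 : ∀ t ∈ I.carrier, 0 ≤ t) (h : ∀ t ∈ I.carrier, t ≤ a)
    (hac : a ≤ c) : I.diagDist ≤ ENNReal.ofReal c := by
  obtain ⟨t, ht⟩ := I.nonempty
  have hc : 0 ≤ c := (h0 t ht).trans ((h t ht).trans hac)
  refine (iInf_le _ (0 : ℝ)).trans (max_le ?_ ?_)
  · exact extDist_coe_le (I.le_birth h0) (I.birth_le ht) (by linarith)
      (by linarith [h t ht])
  · exact extDist_coe_le (I.le_death ht) (I.death_le h) (by linarith [h0 t ht])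
      (by linarith)

end RInterval

/-- The partial matching of the values of two injective families. -/
theorem exists_pequiv_of_injective {A X Y : Type} {f : A → X} {g : A → Y}
    (hf : Function.Injective f) (hg : Function.Injective g) :
    ∃ σ : X ≃. Y, ∀ x y, σ x = some y ↔ ∃ a, f a = x ∧ g a = y := by
  have hf' := hf.isPartialInv
  have hg' := hg.isPartialInv
  have h1 : ∀ x y, (Function.partialInv f x).map g = some y ↔ ∃ a, f a = x ∧ g a = y := by
    intro x y
    simp only [Option.map_eq_some_iff]
    exact exists_congr fun a => and_congr_left fun _ => hf' a x
  have h2 : ∀ x y, (Function.partialInv g y).map f = some x ↔ ∃ a, f a = x ∧ g a = y := by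
    intro x y
    simp only [Option.map_eq_some_iff]
    refine exists_congr fun a => ?_
    rw [and_comm]
    exact and_congr_right fun _ => hg' a y
  exact ⟨⟨fun x => (Function.partialInv f x).map g, fun y => (Function.partialInv g y).map f,
    fun x y => (h2 x y).trans (h1 x y).symm⟩, h1⟩

/-- The barcode of a family of quotients of an `N`-dimensional space at the times `t ≥ 0` by an
increasing family of subspaces whose dimension is `h t` for `t > 0`. -/
def quotientBarcode (N : ℕ) (h : ℝ → ℕ) (hh : Monotone h) : Barcode where
  ι := Fin N
  bar k :=
    -- Putting `0` in by force keeps every bar nonempty; a bar that is only `{0}` lies on the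
    -- diagonal.
    { carrier := {t | 0 ≤ t ∧ (t = 0 ∨ h t ≤ k)}
      nonempty := ⟨0, le_rfl, Or.inl rfl⟩
      ordConnected := ⟨fun _ hs _ ht _ hu => ⟨hs.1.trans hu.1, ht.2.elim
        (fun h0 => Or.inl (le_antisymm (hu.2.trans h0.le) (hs.1.trans hu.1)))
        (fun h1 => Or.inr ((hh hu.2).trans h1))⟩⟩ }

section Matching

variable {C : Barcode} {N : ℕ} {h k : ℝ → ℕ} (hh : Monotone h) {T δ : ℝ}

/-- An enumeration by increasing death times of the bars that contain `T`. -/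
theorem exists_enum_by_death (C : Barcode) (T : ℝ) :
    ∃ (m : ℕ) (f : Fin m → C.ι), m = {i | T ∈ (C.bar i).carrier}.ncard ∧
      Function.Injective f ∧ Set.range f = {i | T ∈ (C.bar i).carrier} ∧
      Monotone fun j => (C.bar (f j)).death := by
  let J : Set C.ι := {i | T ∈ (C.bar i).carrier}
  let e : Fin J.ncard ≃ J := (Finite.equivFinOfCardEq (Nat.card_coe_set_eq J)).symm
  let key : Fin J.ncard → EReal := fun j => (C.bar (e j)).death
  refine ⟨J.ncard, fun j => e (Tuple.sort key j), rfl, fun a b hab => ?_, ?_, Tuple.monotone_sort key⟩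
  · exact (Tuple.sort key).injective (e.injective (Subtype.ext hab))
  · ext i
    constructor
    · rintro ⟨j, rfl⟩
      exact (e _).2
    · intro hi
      exact ⟨(Tuple.sort key).symm (e.symm ⟨i, hi⟩), by simp⟩

/-- After `T`, the sorted deaths of `C` are the jump times of `k`, which are those of `h` up to `δ`.
Births, and whatever happens before `T`, are uncontrolled but cost at most `T`. -/
theorem bottleneckDist_quotientBarcode_le (hT : 0 ≤ T) (hδ : 0 ≤ δ)
    (hpos : ∀ i, ∀ t ∈ (C.bar i).carrier, 0 ≤ t)
    (hbirth : ∀ i t, T ≤ t → t ∈ (C.bar i).carrier → T ∈ (C.bar i).carrier)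
    (hcard : ∀ t, T ≤ t → {i | t ∈ (C.bar i).carrier}.ncard + k t = N)
    (hk : ∀ t, T ≤ t → h (t - δ) ≤ k t) (hk' : ∀ t, T ≤ t → k t ≤ h (t + δ)) :
    bottleneckDist C (quotientBarcode N h hh) ≤ ENNReal.ofReal (T + δ) := by
  obtain ⟨m, f, hmJ, hf, hrange, hmono⟩ := exists_enum_by_death C T
  have hm := hcard T le_rfl
  rw [← hmJ] at hm
  have hfT : ∀ j, T ∈ (C.bar (f j)).carrier := fun j => by
    have : f j ∈ Set.range f := ⟨j, rfl⟩
    rwa [hrange] at this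
  -- The offset `k T` skips the bars of the limit that correspond to classes already dead at time
  -- `T`; they are sent to the diagonal.
  let g : Fin m → Fin N := fun j => ⟨j + k T, by omega⟩
  have hg : Function.Injective g := fun a b hab => by
    have := congrArg Fin.val hab
    simp only [g] at this
    exact Fin.ext (by omega)
  let L := quotientBarcode N h hh
  have hLpos : ∀ i, ∀ t ∈ (L.bar i).carrier, 0 ≤ t := fun i t ht => ht.1
  have hL0 : ∀ i, (0 : ℝ) ∈ (L.bar i).carrier := fun i => ⟨le_rfl, Or.inl rfl⟩
  -- Before the death of bar `j`, the `m - j` bars from `j` on are all alive, while exactly `N - k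
  -- t` bars are alive and `m = N - k T`.
  have alive : ∀ j t, T ≤ t → (t : EReal) < (C.bar (f j)).death → k t ≤ j + k T := by
    intro j t ht hlt
    have hsub : f '' Set.Ici j ⊆ {i | t ∈ (C.bar i).carrier} := by
      rintro _ ⟨j', hj', rfl⟩
      obtain ⟨s, hs, hts⟩ := (C.bar (f j')).exists_mem_gt (hlt.trans_le (hmono hj'))
      exact (C.bar (f j')).ordConnected.out (hfT j') hs ⟨ht, hts.le⟩
    have h1 := Set.ncard_le_ncard hsub
    rw [Set.ncard_image_of_injective _ hf, ← Finset.coe_Ici, Set.ncard_coe_finset,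
      Fin.card_Ici] at h1
    have h2 := hcard t ht
    omega
  -- Conversely, after that death only bars with index above `j` can be alive, since no bar starts
  -- after `T`.
  have dead : ∀ j t, T ≤ t → (C.bar (f j)).death < (t : EReal) → (j : ℕ) + k T < k t := by
    intro j t ht hlt
    have hsub : {i | t ∈ (C.bar i).carrier} ⊆ f '' Set.Ioi j := by
      intro i hi
      have hiT : i ∈ Set.range f := hrange ▸ hbirth i t ht hi
      obtain ⟨j', rfl⟩ := hiT
      refine ⟨j', ?_, rfl⟩
      by_contra hj
      exact absurd ((C.bar _).le_death hi) (not_le.2 ((hmono (not_lt.1 hj)).trans_lt hlt))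
    have h1 := Set.ncard_le_ncard hsub
    rw [Set.ncard_image_of_injective _ hf, ← Finset.coe_Ioi, Set.ncard_coe_finset,
      Fin.card_Ioi] at h1
    have h2 := hcard t ht
    have h3 := j.2
    omega
  have hpoint : ∀ j, (C.bar (f j)).pointDist (L.bar (g j)) ≤ ENNReal.ofReal (T + δ) := by
    intro j
    have hD0 : (T : EReal) ≤ (C.bar (f j)).death := (C.bar (f j)).le_death (hfT j)
    have hL0' : ((0 : ℝ) : EReal) ≤ (L.bar (g j)).death := (L.bar (g j)).le_death (hL0 _)
    refine max_le ?_ ?_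
    · have hb : (L.bar (g j)).birth = ((0 : ℝ) : EReal) :=
        le_antisymm ((L.bar (g j)).birth_le (hL0 _)) ((L.bar (g j)).le_birth (hLpos _))
      rw [hb]
      exact extDist_coe_le ((C.bar (f j)).le_birth (hpos _)) ((C.bar (f j)).birth_le (hfT j))
        (by linarith) (by linarith)
    · refine extDist_le (fun h0 => ?_) (fun h0 => ?_) ?_ ?_
      · rw [h0] at hD0
        exact absurd hD0 (by simp)
      · rw [h0] at hL0'
        exact absurd hL0' (by simp)
      · by_contra hc
        obtain ⟨t, ht1, ht2⟩ := EReal.lt_iff_exists_real_btwn.1 (not_le.1 hc)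
        have ht3 : 0 + (T + δ) < t := by
          rw [← EReal.coe_lt_coe_iff, EReal.coe_add]
          exact (add_le_add_left hL0' _).trans_lt ht1
        have h1 := (hk t (by linarith)).trans (alive j t (by linarith) ht2)
        have h2 : t - δ ∈ (L.bar (g j)).carrier := ⟨by linarith, Or.inr h1⟩
        have h3 : t - δ + (T + δ) < t := by
          rw [← EReal.coe_lt_coe_iff, EReal.coe_add]
          exact (add_le_add_left ((L.bar (g j)).le_death h2) _).trans_lt ht1
        linarith
      · by_contra hc
        obtain ⟨t, ht1, ht2⟩ := EReal.lt_iff_exists_real_btwn.1 (not_le.1 hc)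
        have ht3 : T + (T + δ) < t := by
          rw [← EReal.coe_lt_coe_iff, EReal.coe_add]
          exact (add_le_add_left hD0 _).trans_lt ht1
        -- The extra `T` in the cost guarantees `t - δ ≥ T`, where `dead` and `hk'` apply.
        have ht4 : (C.bar (f j)).death < ((t - δ : ℝ) : EReal) := by
          by_contra h4
          have h5 : t - δ + (T + δ) < t := by
            rw [← EReal.coe_lt_coe_iff, EReal.coe_add]
            exact (add_le_add_left (not_lt.1 h4) _).trans_lt ht1
          linarith
        have h1 := (dead j (t - δ) (by linarith) ht4).trans_le (hk' _ (by linarith))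
        rw [sub_add_cancel] at h1
        obtain ⟨s, hs, hts⟩ := (L.bar (g j)).exists_mem_gt ht2
        rcases hs.2 with h2 | h2
        · linarith
        · exact absurd (h1.trans_le (hh hts.le)) (not_lt.2 h2)
  obtain ⟨σ, hσ⟩ := exists_pequiv_of_injective (Y := L.ι) hf hg
  refine (iInf_le _ σ).trans (sup_le ?_ (sup_le ?_ ?_))
  · refine iSup_le fun i => iSup_le fun j => iSup_le fun hij => ?_
    obtain ⟨a, rfl, rfl⟩ := (hσ i j).1 hij
    exact hpoint a
  · refine iSup_le fun i => iSup_le fun hi => ?_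
    have hiT : T ∉ (C.bar i).carrier := fun hiT => by
      have : i ∈ Set.range f := hrange ▸ hiT
      obtain ⟨a, rfl⟩ := this
      rw [(hσ (f a) (g a)).2 ⟨a, rfl, rfl⟩] at hi
      cases hi
    refine (C.bar i).diagDist_le (hpos i) (a := T) (fun t ht => ?_) (by linarith)
    by_contra htT
    exact hiT (hbirth i t (not_le.1 htT).le ht)
  · refine iSup_le fun (j : Fin N) => iSup_le fun hj => ?_
    have hjk : (j : ℕ) < k T := by
      by_contra hjk
      have hj2 : (j : ℕ) < N := j.2
      have : σ (f ⟨j - k T, by omega⟩) = some j :=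
        (hσ _ _).2 ⟨_, rfl, Fin.ext (by simp only [g]; omega)⟩
      cases hj.symm.trans (σ.eq_some_iff.2 this)
    refine (L.bar j).diagDist_le (hLpos j) (a := T + δ) (fun t ht => ?_) le_rfl
    by_contra htT
    push Not at htT
    rcases ht.2 with h2 | h2
    · linarith
    · exact absurd (hjk.trans_le ((hk' T le_rfl).trans (hh htT.le))) (not_lt.2 h2)

end Matching

/-! ### Dimensions of the values of a persistent vector space -/

open scoped Classical in
theorem RInterval.finrank_fiber (I : RInterval) (t : ℝ) :
    Module.finrank ℝ (I.fiber t) = if t ∈ I.carrier then 1 else 0 := by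
  split_ifs with h
  · have : I.fiber t = ⊤ := by
      ext x
      exact ⟨fun _ => trivial, fun _ h' => absurd h h'⟩
    rw [this, finrank_top, Module.finrank_self]
  · have : I.fiber t = ⊥ := by
      ext x
      exact ⟨fun hx => hx h, fun hx _ => hx⟩
    rw [this, finrank_bot]

variable {M : PersVec} {C : Barcode}

theorem IsBarcode.finrank_eq (hM : IsBarcode M C) (t : ℝ) :
    Module.finrank ℝ (M.obj t) = {i | t ∈ (C.bar i).carrier}.ncard := by
  classical
  obtain ⟨e⟩ := hM
  have := Fintype.ofFinite C.ι
  rw [(e.app t).toLinearEquiv.finrank_eq]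
  change Module.finrank ℝ (∀ i, (C.bar i).fiber t) = _
  rw [Module.finrank_pi_fintype]
  simp only [RInterval.finrank_fiber]
  rw [Finset.sum_boole, Nat.cast_id, Set.ncard_eq_toFinset_card']
  congr 1
  ext i
  simp

/-- If `s` were outside the bar, its summand would vanish at `s`, and the generator of the summand
at `t` would not be in the image. -/
theorem IsBarcode.mem_of_surjective (hM : IsBarcode M C) {s t : ℝ} (hst : s ≤ t)
    (hsurj : Function.Surjective (M.map (homOfLE hst)).hom) {i : C.ι}
    (ht : t ∈ (C.bar i).carrier) : s ∈ (C.bar i).carrier := by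
  classical
  obtain ⟨e⟩ := hM
  by_contra hs
  let y : ∀ i, (C.bar i).fiber t := Pi.single i ⟨1, fun h => absurd ht h⟩
  obtain ⟨x, hx⟩ := hsurj ((e.inv.app t).hom y)
  have h1 := congrArg (e.hom.app t).hom hx
  have h2 : (e.hom.app t).hom ((e.inv.app t).hom y) = y := by
    have := congrArg (fun φ => φ.hom y) (e.inv_hom_id_app t)
    exact this
  have h3 : (e.hom.app t).hom ((M.map (homOfLE hst)).hom x) =
      ((directSum fun i => intervalModule (C.bar i)).map (homOfLE hst)).hom
        ((e.hom.app s).hom x) := by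
    have := congrArg (fun φ => φ.hom x) (e.hom.naturality (homOfLE hst))
    exact this
  rw [h2, h3] at h1
  let z : ∀ i, (C.bar i).fiber s := (e.hom.app s).hom x
  have h4 : (C.bar i).fiberMap s t (z i) = y i := congrFun h1 i
  have h5 := congrArg Subtype.val h4
  rw [RInterval.fiberMap_apply, if_pos ht, (z i).2 hs] at h5
  simp [y] at h5

/-! ### Low-dimensional path chains and induced maps -/

section Chains

variable {V V' : Type}

open scoped Classical in
/-- The elementary path `v` if it is regular, and `0` otherwise. -/
def regularPath {p : ℕ} (v : Fin (p + 1) → V) : Chains V p :=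
  if IsRegular v then Finsupp.single v 1 else 0

/-- The elementary `0`-path at `a`. -/
def vertex (a : V) : Chains V 0 := Finsupp.single ![a] 1

/-- The elementary path `a b`, which is `0` if `a = b`. -/
def edge (a b : V) : Chains V 1 := regularPath ![a, b]

theorem isRegular_zero (v : Fin (0 + 1) → V) : IsRegular v := fun i => i.elim0

theorem isRegular_one {v : Fin (1 + 1) → V} : IsRegular v ↔ v 0 ≠ v 1 :=
  ⟨fun h => h 0, fun h i => by rw [Subsingleton.elim i 0]; exact h⟩

theorem isAllowed_one {K : Digraph V} {v : Fin (1 + 1) → V} :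
    IsAllowed K v ↔ K.Adj (v 0) (v 1) :=
  ⟨fun h => h 0, fun h i => by rw [Subsingleton.elim i 0]; exact h⟩

theorem isRegular_two {v : Fin (2 + 1) → V} : IsRegular v ↔ v 0 ≠ v 1 ∧ v 1 ≠ v 2 :=
  Fin.forall_fin_two

theorem isAllowed_two {K : Digraph V} {v : Fin (2 + 1) → V} :
    IsAllowed K v ↔ K.Adj (v 0) (v 1) ∧ K.Adj (v 1) (v 2) :=
  Fin.forall_fin_two

@[simp]
theorem edge_self (a : V) : edge a a = 0 := if_neg fun h => isRegular_one.1 h rfl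

theorem edge_of_ne {a b : V} (h : a ≠ b) : edge a b = Finsupp.single ![a, b] 1 :=
  if_pos (isRegular_one.2 h)

theorem boundary_zero_single (v : Fin (1 + 1) → V) :
    boundary V 0 (Finsupp.single v 1) = vertex (v 1) - vertex (v 0) := by
  have h0 : v ∘ (0 : Fin 2).succAbove = ![v 1] := by
    ext i; fin_cases i; rfl
  have h1 : v ∘ (1 : Fin 2).succAbove = ![v 0] := by
    ext i; fin_cases i; rfl
  simp only [boundary, Finsupp.linearCombination_single, one_smul]
  rw [Fin.sum_univ_two, h0, h1, if_pos (isRegular_zero _), if_pos (isRegular_zero _)]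
  simp [vertex, sub_eq_add_neg]

theorem boundary_one_single (v : Fin (2 + 1) → V) :
    boundary V 1 (Finsupp.single v 1) =
      edge (v 1) (v 2) - edge (v 0) (v 2) + edge (v 0) (v 1) := by
  have h0 : v ∘ (0 : Fin 3).succAbove = ![v 1, v 2] := by
    ext i; fin_cases i <;> rfl
  have h1 : v ∘ (1 : Fin 3).succAbove = ![v 0, v 2] := by
    ext i; fin_cases i <;> rfl
  have h2 : v ∘ (2 : Fin 3).succAbove = ![v 0, v 1] := by
    ext i; fin_cases i <;> rfl
  simp only [boundary, Finsupp.linearCombination_single, one_smul]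
  rw [Fin.sum_univ_three, h0, h1, h2]
  change _ • regularPath _ + _ • regularPath _ + _ • regularPath _ = _
  simp [edge, sub_eq_add_neg]

theorem boundary_zero_edge (a b : V) : boundary V 0 (edge a b) = vertex b - vertex a := by
  by_cases h : a = b
  · subst h
    simp
  · rw [edge_of_ne h, boundary_zero_single]
    rfl

theorem boundary_zero_boundary_one (x : Chains V 2) : boundary V 0 (boundary V 1 x) = 0 := by
  have : boundary V 0 ∘ₗ boundary V 1 = 0 := by
    refine Finsupp.lhom_ext' fun v => LinearMap.ext_ring ?_
    simp only [LinearMap.comp_apply, Finsupp.lsingle_apply, boundary_one_single, map_add, map_sub,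
      boundary_zero_edge, LinearMap.zero_apply]
    abel
  exact LinearMap.congr_fun this x

theorem allowed_le {K : Digraph V} {p : ℕ} {X : Submodule ℝ (Chains V p)}
    (h : ∀ v, IsAllowed K v → Finsupp.single v 1 ∈ X) : allowed K p ≤ X := by
  rw [allowed, Finsupp.supported_eq_span_single, Submodule.span_le]
  rintro _ ⟨v, hv, rfl⟩
  exact h v hv

theorem single_mem_allowed {K : Digraph V} {p : ℕ} {v : Fin (p + 1) → V} (h : IsAllowed K v) :
    Finsupp.single v 1 ∈ allowed K p :=
  Finsupp.single_mem_supported ℝ _ h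

theorem edge_mem_allowed {K : Digraph V} {a b : V} (h : K.Adj a b) : edge a b ∈ allowed K 1 := by
  by_cases hab : a = b
  · rw [hab, edge_self]
    exact zero_mem _
  · rw [edge_of_ne hab]
    exact single_mem_allowed (isAllowed_one.2 h)

theorem allowed_one_le {K : Digraph V} (hK : ∀ a, ¬ K.Adj a a) {X : Submodule ℝ (Chains V 1)}
    (h : ∀ a b, K.Adj a b → edge a b ∈ X) : allowed K 1 ≤ X := by
  refine allowed_le fun v hv => ?_
  have hv' := isAllowed_one.1 hv
  have := h _ _ hv'
  rw [edge_of_ne fun h0 => hK _ (h0 ▸ hv')] at this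
  rwa [show v = ![v 0, v 1] by ext i; fin_cases i <;> rfl]

/-- Every `0`-path is allowed, so the invariance condition in degree one is void. -/
theorem mem_cycles {K : Digraph V} {x : Chains V 1} :
    x ∈ cycles K ↔ x ∈ allowed K 1 ∧ boundary V 0 x = 0 := by
  have : boundary V 0 x ∈ allowed K 0 := fun v _ i => i.elim0
  exact ⟨fun h => ⟨h.1.1, h.2⟩, fun h => ⟨⟨h.1, this⟩, h.2⟩⟩

theorem boundaries_le_cycles (K : Digraph V) : boundaries K ≤ cycles K := by
  rintro _ ⟨x, hx, rfl⟩
  exact mem_cycles.2 ⟨hx.2, boundary_zero_boundary_one x⟩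

/-- The only explicit source of boundaries: all others below are images of given ones under weak
maps, or sums of the two kinds. -/
theorem triangle_mem_boundaries {K : Digraph V} {a b c : V} (hab : K.Adj a b) (hbc : K.Adj b c)
    (hac : K.Adj a c) : edge b c - edge a c + edge a b ∈ boundaries K := by
  have h := boundary_one_single ![a, b, c]
  refine ⟨_, ⟨single_mem_allowed (isAllowed_two.2 ⟨hab, hbc⟩), ?_⟩, h⟩
  change boundary V 1 _ ∈ allowed K 1
  rw [h]
  exact add_mem (sub_mem (edge_mem_allowed hbc) (edge_mem_allowed hac)) (edge_mem_allowed hab)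

/-- The map of path chains induced by a map of vertices. -/
def push (f : V → V') (p : ℕ) : Chains V p →ₗ[ℝ] Chains V' p :=
  Finsupp.linearCombination ℝ fun v => regularPath (f ∘ v)

theorem push_single (f : V → V') {p : ℕ} (v : Fin (p + 1) → V) :
    push f p (Finsupp.single v 1) = regularPath (f ∘ v) := by
  simp [push]

theorem comp_vecCons_one (f : V → V') (a b : V) : f ∘ ![a, b] = ![f a, f b] := by
  ext i; fin_cases i <;> rfl

@[simp]
theorem push_edge (f : V → V') (a b : V) : push f 1 (edge a b) = edge (f a) (f b) := by
  by_cases h : a = b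
  · subst h
    simp
  · rw [edge_of_ne h, push_single, comp_vecCons_one]
    rfl

theorem push_vertex (f : V → V') (a : V) : push f 0 (vertex a) = vertex (f a) := by
  rw [vertex, push_single, regularPath, if_pos (isRegular_zero _)]
  congr 1
  ext i; fin_cases i; rfl

theorem boundary_zero_push (f : V → V') (x : Chains V 1) :
    boundary V' 0 (push f 1 x) = push f 0 (boundary V 0 x) := by
  have : boundary V' 0 ∘ₗ push f 1 = push f 0 ∘ₗ boundary V 0 := by
    refine Finsupp.lhom_ext' fun v => LinearMap.ext_ring ?_
    simp only [LinearMap.comp_apply, Finsupp.lsingle_apply, boundary_zero_single, map_sub,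
      push_vertex, push_single]
    rw [show f ∘ v = ![f (v 0), f (v 1)] by ext i; fin_cases i <;> rfl]
    exact boundary_zero_edge _ _
  exact LinearMap.congr_fun this x

theorem boundary_one_push (f : V → V') (x : Chains V 2) :
    boundary V' 1 (push f 2 x) = push f 1 (boundary V 1 x) := by
  have : boundary V' 1 ∘ₗ push f 2 = push f 1 ∘ₗ boundary V 1 := by
    refine Finsupp.lhom_ext' fun v => LinearMap.ext_ring ?_
    simp only [LinearMap.comp_apply, Finsupp.lsingle_apply, boundary_one_single, map_sub, map_add,
      push_edge, push_single]
    by_cases h : IsRegular (f ∘ v)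
    · rw [regularPath, if_pos h, boundary_one_single]
      rfl
    · rw [regularPath, if_neg h, map_zero]
      -- If two consecutive vertices are identified, one face degenerates to `0` and the other two
      -- are equal with opposite signs.
      rw [isRegular_two, not_and_or, not_not, not_not] at h
      simp only [Function.comp_apply] at h
      rcases h with h | h <;> simp [h]
  exact LinearMap.congr_fun this x

/-- A weak digraph map: edges are mapped to edges or collapsed. -/
def IsWeakMap (K : Digraph V) (K' : Digraph V') (f : V → V') : Prop :=
  ∀ a b, K.Adj a b → f a = f b ∨ K'.Adj (f a) (f b)

variable {K : Digraph V} {K' : Digraph V'} {f : V → V'}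

theorem IsWeakMap.allowed_le (hf : IsWeakMap K K' f) (p : ℕ) :
    allowed K p ≤ (allowed K' p).comap (push f p) := by
  refine GrPPH.allowed_le fun v hv => ?_
  rw [Submodule.mem_comap, push_single, regularPath]
  split_ifs with h
  · exact single_mem_allowed fun i => (hf _ _ (hv i)).resolve_left (h i)
  · exact zero_mem _

theorem IsWeakMap.push_mem_cycles (hf : IsWeakMap K K' f) {x : Chains V 1} (hx : x ∈ cycles K) :
    push f 1 x ∈ cycles K' := by
  rw [mem_cycles] at hx ⊢
  exact ⟨hf.allowed_le 1 hx.1, by rw [boundary_zero_push, hx.2, map_zero]⟩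

theorem IsWeakMap.push_mem_boundaries (hf : IsWeakMap K K' f) {x : Chains V 1}
    (hx : x ∈ boundaries K) : push f 1 x ∈ boundaries K' := by
  obtain ⟨y, hy, rfl⟩ := hx
  refine ⟨push f 2 y, ⟨hf.allowed_le 2 hy.1, ?_⟩, boundary_one_push f y⟩
  change boundary V' 1 _ ∈ allowed K' 1
  rw [boundary_one_push]
  exact hf.allowed_le 1 hy.2

theorem cycles_eq_bot (hK : ∀ a b, ¬ K.Adj a b) : cycles K = ⊥ := by
  rw [eq_bot_iff]
  intro x hx
  exact allowed_le (X := ⊥) (fun v hv => absurd (isAllowed_one.1 hv) (hK _ _)) (mem_cycles.1 hx).1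

end Chains

/-! ### The shortest-path filtration -/

namespace WDigraph

variable {G : WDigraph}

/-- There is a directed walk from `a` to `b` of length `r`. -/
inductive Walk (G : WDigraph) : G.V → G.V → ℝ → Prop
  | refl (a : G.V) : Walk G a a 0
  | cons {a c b : G.V} {r : ℝ} (h : G.graph.Adj a c) (hr : Walk G c b r) :
      Walk G a b (G.w a c + r)

theorem Walk.nonneg {a b : G.V} {r : ℝ} (h : G.Walk a b r) : 0 ≤ r := by
  induction h with
  | refl => exact le_rfl
  | cons h _ ih => exact add_nonneg (G.w_pos _ _ h).le ih

theorem walk_pathLength {b : G.V} : ∀ {l : List G.V} {a : G.V}, l.IsChain G.graph.Adj →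
    l.head? = some a → l.getLast? = some b → G.Walk a b (G.pathLength l)
  | [], a, _, h, _ => by simp at h
  | [c], a, _, h1, h2 => by
    simp only [List.head?_cons, Option.some.injEq, List.getLast?_singleton] at h1 h2
    subst h1 h2
    exact Walk.refl _
  | c :: d :: l, a, h, h1, h2 => by
    simp only [List.head?_cons, Option.some.injEq] at h1
    subst h1
    rw [List.isChain_cons_cons] at h
    exact Walk.cons h.1 (walk_pathLength h.2 rfl (by rwa [List.getLast?_cons_cons] at h2))

theorem pathLength_le_cons (c : G.V) {l : List G.V} (h : (c :: l).IsChain G.graph.Adj) :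
    G.pathLength l ≤ G.pathLength (c :: l) := by
  cases l with
  | nil => exact le_rfl
  | cons d l => exact le_add_of_nonneg_left (G.w_pos _ _ (List.isChain_cons_cons.1 h).1).le

/-- The part of a path from `a` on is again a path, and no longer since weights are positive. This
removes loops from walks. -/
theorem exists_isPath_of_mem {a b : G.V} : ∀ {l : List G.V} {c : G.V}, G.IsPath c b l → a ∈ l →
    ∃ l', G.IsPath a b l' ∧ G.pathLength l' ≤ G.pathLength l
  | [], c, _, ha => by simp at ha
  | d :: l, c, h, ha => by
    by_cases had : a = d
    · subst had
      exact ⟨a :: l, ⟨h.1, h.2.1, rfl, h.2.2.2⟩, le_rfl⟩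
    · have ha' : a ∈ l := (List.mem_cons.1 ha).resolve_left had
      cases l with
      | nil => simp at ha'
      | cons e l =>
        obtain ⟨l', hl', hle⟩ := exists_isPath_of_mem (l := e :: l) (c := e)
          ⟨(List.isChain_cons_cons.1 h.1).2, (List.nodup_cons.1 h.2.1).2, rfl, by
            rw [← h.2.2.2, List.getLast?_cons_cons]⟩ ha'
        exact ⟨l', hl', hle.trans (pathLength_le_cons d h.1)⟩

theorem Walk.exists_isPath {a b : G.V} {r : ℝ} (h : G.Walk a b r) :
    ∃ l, G.IsPath a b l ∧ G.pathLength l ≤ r := by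
  induction h with
  | refl a => exact ⟨[a], ⟨by simp, by simp, rfl, rfl⟩, le_rfl⟩
  | @cons a c b r hac _ ih =>
    obtain ⟨l, hl, hle⟩ := ih
    have hw := G.w_pos _ _ hac
    by_cases ha : a ∈ l
    · obtain ⟨l', hl', hle'⟩ := exists_isPath_of_mem hl ha
      exact ⟨l', hl', by linarith⟩
    · obtain ⟨h1, h2, h3, h4⟩ := hl
      cases l with
      | nil => simp at h3
      | cons d l =>
        simp only [List.head?_cons, Option.some.injEq] at h3
        subst h3
        exact ⟨a :: d :: l, ⟨List.isChain_cons_cons.2 ⟨hac, h1⟩, List.nodup_cons.2 ⟨ha, h2⟩, rfl,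
          by rw [List.getLast?_cons_cons, h4]⟩, by simpa [pathLength] using hle⟩

/-- There are finitely many paths without repetition, so the infimum is attained. Walks replace
paths from here on because they concatenate and can be pushed along maps. -/
theorem dist_le_iff {a b : G.V} {t : ℝ} :
    G.dist a b ≤ (t : EReal) ↔ ∃ r, G.Walk a b r ∧ r ≤ t := by
  classical
  constructor
  · intro h
    have := Fintype.ofFinite G.V
    let S : Set (List G.V) := {l | G.IsPath a b l}
    have hfin : S.Finite :=
      Set.Finite.subset (Finite.of_fintype {l : List G.V // l.Nodup}) fun l hl => hl.2.1
    rcases S.eq_empty_or_nonempty with hS | hS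
    · have : G.dist a b = ⊤ := by
        refine iInf_eq_top.2 fun l => iInf_eq_top.2 fun hl => ?_
        exact absurd (show l ∈ S from hl) (by simp [hS])
      rw [this] at h
      exact absurd h (not_le.2 (EReal.coe_lt_top t))
    · obtain ⟨l, hl, hmin⟩ := Set.exists_min_image S G.pathLength hfin hS
      refine ⟨_, walk_pathLength hl.1 hl.2.2.1 hl.2.2.2, ?_⟩
      rw [← EReal.coe_le_coe_iff]
      exact le_trans (le_iInf₂ fun l' hl' => EReal.coe_le_coe_iff.2 (hmin l' hl')) h
  · rintro ⟨r, hr, hrt⟩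
    obtain ⟨l, hl, hle⟩ := hr.exists_isPath
    exact (iInf₂_le l hl).trans (EReal.coe_le_coe_iff.2 (hle.trans hrt))

theorem shortestPath_adj {a b : G.V} {t : ℝ} :
    (G.shortestPath t).Adj a b ↔ a ≠ b ∧ ∃ r, G.Walk a b r ∧ r ≤ t :=
  and_congr_right fun _ => dist_le_iff

theorem not_shortestPath_adj_of_neg {t : ℝ} (ht : t < 0) (a b : G.V) :
    ¬ (G.shortestPath t).Adj a b := by
  rw [shortestPath_adj]
  rintro ⟨-, r, hr, hrt⟩
  linarith [hr.nonneg]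

theorem Walk.of_adj {a b : G.V} (h : G.graph.Adj a b) : G.Walk a b (G.w a b) := by
  simpa using Walk.cons h (Walk.refl b)

theorem ne_of_adj {a b : G.V} (h : G.graph.Adj a b) : a ≠ b := by
  rintro rfl
  exact G.loopless _ h

theorem le_shortestPath {t : ℝ} (h : ∀ a b, G.graph.Adj a b → G.w a b ≤ t) :
    G.graph ≤ G.shortestPath t := fun _ _ hab =>
  shortestPath_adj.2 ⟨ne_of_adj hab, _, Walk.of_adj hab, h _ _ hab⟩

/-- Fan triangulation of a walk: the triangle `a c b`, with `c` the second vertex, splits off the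
first edge and leaves the edge spanned by the remaining walk, which is shorter. -/
theorem Walk.edge_mem {t : ℝ} (hG : G.graph ≤ G.shortestPath t) {a b : G.V} {r : ℝ}
    (h : G.Walk a b r) (hr : r ≤ t) :
    edge a b ∈ allowed G.graph 1 ⊔ boundaries (G.shortestPath t) := by
  induction h with
  | refl a =>
    rw [edge_self]
    exact zero_mem _
  | @cons a c b r hac hcb ih =>
    have hw := G.w_pos _ _ hac
    have h1 : edge a c ∈ allowed G.graph 1 ⊔ boundaries (G.shortestPath t) :=
      Submodule.mem_sup_left (edge_mem_allowed hac)
    -- A walk may close up, and its tail may too; the triangle then degenerates, but the edges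
    -- concerned are `0`.
    by_cases hab : a = b
    · rw [hab, edge_self]
      exact zero_mem _
    by_cases hcb' : c = b
    · rwa [← hcb']
    have h2 := ih (by linarith)
    have h3 : edge c b - edge a b + edge a c ∈
        allowed G.graph 1 ⊔ boundaries (G.shortestPath t) :=
      Submodule.mem_sup_right (triangle_mem_boundaries (hG hac)
        (shortestPath_adj.2 ⟨hcb', r, hcb, by linarith⟩)
        (shortestPath_adj.2 ⟨hab, _, Walk.cons hac hcb, hr⟩))
    have h4 : edge a b = edge c b + edge a c - (edge c b - edge a b + edge a c) := by abel
    rw [h4]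
    exact sub_mem (add_mem h2 h1) h3

/-- Modulo boundaries each edge of `G^t` is a chain of edges of `G`. The chain of `G` obtained from
a cycle is itself a cycle, because boundaries are cycles. -/
theorem cycles_shortestPath {t : ℝ} (hG : G.graph ≤ G.shortestPath t) :
    cycles (G.shortestPath t) = cycles G.graph ⊔ boundaries (G.shortestPath t) := by
  refine le_antisymm (fun x hx => ?_) (sup_le (cycles_mono hG) (boundaries_le_cycles _))
  rw [mem_cycles] at hx
  have hle : allowed (G.shortestPath t) 1 ≤ allowed G.graph 1 ⊔ boundaries (G.shortestPath t) :=
    allowed_one_le (K := G.shortestPath t) (fun a h => h.1 rfl) fun a b hab => by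
      obtain ⟨-, r, hr, hrt⟩ := shortestPath_adj.1 hab
      exact hr.edge_mem hG hrt
  obtain ⟨y, hy, z, hz, rfl⟩ := Submodule.mem_sup.1 (hle hx.1)
  refine add_mem (Submodule.mem_sup_left (mem_cycles.2 ⟨hy, ?_⟩)) (Submodule.mem_sup_right hz)
  have h1 := hx.2
  rw [map_add, (mem_cycles.1 (boundaries_le_cycles _ hz)).2, add_zero] at h1
  exact h1

/-- The dimension of the space of the cycles of `G` that are boundaries in `G^t`. -/
def nullRank (G : WDigraph) (t : ℝ) : ℕ :=
  Module.finrank ℝ ↥(cycles G.graph ⊓ boundaries (G.shortestPath t))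

theorem nullRank_mono : Monotone G.nullRank := fun _ _ h =>
  Submodule.finrank_mono (inf_le_inf_left _ (boundaries_mono (G.shortestPath_mono h)))

theorem nullRank_le (t : ℝ) : G.nullRank t ≤ Module.finrank ℝ (cycles G.graph) :=
  Submodule.finrank_mono inf_le_left

theorem nullRank_of_neg {t : ℝ} (ht : t < 0) : G.nullRank t = 0 := by
  have : boundaries (G.shortestPath t) = ⊥ :=
    eq_bot_iff.2 ((boundaries_le_cycles _).trans
      (cycles_eq_bot (not_shortestPath_adj_of_neg ht)).le)
  rw [nullRank, this, inf_bot_eq, finrank_bot]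

end WDigraph

/-! ### Subdivision -/

namespace WDigraph

variable (G : WDigraph)

/-- An edge of `G`. -/
abbrev EdgeType : Type := {e : G.V × G.V // G.graph.Adj e.1 e.2}

/-- A vertex of `G` as a vertex of the medial subdivision. -/
def old (a : G.V) : G.medial.V := Sum.inl a

/-- The midpoint of an edge. -/
def mid (e : G.EdgeType) : G.medial.V := Sum.inr e

theorem medial_cases {motive : G.medial.V → Prop} (old : ∀ a, motive (G.old a))
    (mid : ∀ e, motive (G.mid e)) (x : G.medial.V) : motive x :=
  Sum.rec old mid x

variable {G}

theorem adj_old_mid (e : G.EdgeType) : G.medial.graph.Adj (G.old e.1.1) (G.mid e) :=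
  show e.1.1 = e.1.1 from rfl

theorem adj_mid_old (e : G.EdgeType) : G.medial.graph.Adj (G.mid e) (G.old e.1.2) :=
  show e.1.2 = e.1.2 from rfl

theorem w_old_mid (a : G.V) (e : G.EdgeType) :
    G.medial.w (G.old a) (G.mid e) = G.w e.1.1 e.1.2 / 2 := rfl

theorem w_mid_old (a : G.V) (e : G.EdgeType) :
    G.medial.w (G.mid e) (G.old a) = G.w e.1.1 e.1.2 / 2 := rfl

theorem medial_adj_cases {x y : G.medial.V} (h : G.medial.graph.Adj x y) :
    ∃ e : G.EdgeType, (x = G.old e.1.1 ∧ y = G.mid e) ∨ (x = G.mid e ∧ y = G.old e.1.2) := by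
  induction x using medial_cases with
  | old a =>
    induction y using medial_cases with
    | old b => exact h.elim
    | mid e =>
      have ha : a = e.1.1 := h
      exact ⟨e, Or.inl ⟨by rw [ha], rfl⟩⟩
  | mid e =>
    induction y using medial_cases with
    | old b =>
      have hb : b = e.1.2 := h
      exact ⟨e, Or.inr ⟨rfl, by rw [hb]⟩⟩
    | mid e' => exact h.elim

theorem medial_w_le {W : ℝ} (hW : ∀ a b, G.graph.Adj a b → G.w a b ≤ W) (x y : G.medial.V)
    (h : G.medial.graph.Adj x y) : G.medial.w x y ≤ W / 2 := by
  obtain ⟨e, ⟨rfl, rfl⟩ | ⟨rfl, rfl⟩⟩ := medial_adj_cases h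
  · rw [w_old_mid]
    linarith [hW _ _ e.2]
  · rw [w_mid_old]
    linarith [hW _ _ e.2]

variable (G)

/-- The map of the medial subdivision that collapses the second half of every edge. -/
def collapse : G.medial.V → G.V := Sum.elim id fun e => e.1.2

/-- The distance by which `collapse` moves a vertex. -/
def lag : G.medial.V → ℝ := Sum.elim (fun _ => 0) fun e => G.w e.1.1 e.1.2 / 2

@[simp] theorem collapse_old (a : G.V) : G.collapse (G.old a) = a := rfl
@[simp] theorem collapse_mid (e : G.EdgeType) : G.collapse (G.mid e) = e.1.2 := rfl
@[simp] theorem lag_old (a : G.V) : G.lag (G.old a) = 0 := rfl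
@[simp] theorem lag_mid (e : G.EdgeType) : G.lag (G.mid e) = G.w e.1.1 e.1.2 / 2 := rfl

variable {G}

theorem lag_nonneg (x : G.medial.V) : 0 ≤ G.lag x := by
  induction x using medial_cases with
  | old a => exact le_rfl
  | mid e => exact (half_pos (G.w_pos _ _ e.2)).le

theorem lag_le {W : ℝ} (hW0 : 0 ≤ W) (hW : ∀ a b, G.graph.Adj a b → G.w a b ≤ W)
    (x : G.medial.V) : G.lag x ≤ W := by
  induction x using medial_cases with
  | old a => exact hW0
  | mid e =>
    rw [lag_mid]
    linarith [hW _ _ e.2]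

theorem Walk.old {a b : G.V} {r : ℝ} (h : G.Walk a b r) :
    G.medial.Walk (G.old a) (G.old b) r := by
  induction h with
  | refl a => exact Walk.refl _
  | @cons a c b r hac _ ih =>
    have h := Walk.cons (adj_old_mid ⟨(a, c), hac⟩) (Walk.cons (adj_mid_old ⟨(a, c), hac⟩) ih)
    rwa [w_old_mid, w_mid_old, ← add_assoc, add_halves] at h

/-- `lag` measures how far the collapsed vertex has run ahead. Entering a midpoint costs a whole
edge instead of half, leaving it costs nothing, so the corrections telescope to the two endpoints.
-/
theorem Walk.collapse {x y : G.medial.V} {r : ℝ} (h : G.medial.Walk x y r) :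
    G.Walk (G.collapse x) (G.collapse y) (r + G.lag y - G.lag x) := by
  induction h with
  | refl x =>
    rw [zero_add, sub_self]
    exact Walk.refl _
  | @cons x z y r hxz _ ih =>
    obtain ⟨e, ⟨rfl, rfl⟩ | ⟨rfl, rfl⟩⟩ := medial_adj_cases hxz
    · have h := Walk.cons e.2 ih
      have h0 : G.w e.1.1 e.1.2 + (r + G.lag y - G.lag (G.mid e)) =
          G.w e.1.1 e.1.2 / 2 + r + G.lag y - 0 := by
        rw [lag_mid]
        ring
      rw [h0] at h
      exact h
    · have h0 : r + G.lag y - G.lag (G.old e.1.2) =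
          G.w e.1.1 e.1.2 / 2 + r + G.lag y - G.w e.1.1 e.1.2 / 2 := by
        rw [lag_old]
        ring
      rw [h0] at ih
      exact ih

theorem isWeakMap_old {s t : ℝ} (hst : s ≤ t) :
    IsWeakMap (G.shortestPath s) (G.medial.shortestPath t) G.old := by
  intro a b hab
  obtain ⟨hne, r, hr, hrs⟩ := shortestPath_adj.1 hab
  exact Or.inr (shortestPath_adj.2 ⟨fun h => hne (Sum.inl_injective h), r, hr.old,
    hrs.trans hst⟩)

theorem isWeakMap_collapse {W : ℝ} (hW0 : 0 ≤ W) (hW : ∀ a b, G.graph.Adj a b → G.w a b ≤ W)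
    (t : ℝ) : IsWeakMap (G.medial.shortestPath t) (G.shortestPath (t + W)) G.collapse := by
  intro x y hxy
  obtain ⟨-, r, hr, hrt⟩ := shortestPath_adj.1 hxy
  refine or_iff_not_imp_left.2 fun hne => shortestPath_adj.2 ⟨hne, _, hr.collapse, ?_⟩
  linarith [lag_le hW0 hW y, lag_nonneg x]

theorem isWeakMap_collapse_graph : IsWeakMap G.medial.graph G.graph G.collapse := by
  intro x y hxy
  obtain ⟨e, ⟨rfl, rfl⟩ | ⟨rfl, rfl⟩⟩ := medial_adj_cases hxy
  · exact Or.inr e.2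
  · exact Or.inl rfl

variable (G)

open scoped Classical in
/-- The subdivision of `1`-chains: every edge is mapped to the sum of its halves. -/
def subdivide : Chains G.V 1 →ₗ[ℝ] Chains G.medial.V 1 :=
  Finsupp.linearCombination ℝ fun v =>
    -- The value off the edges of `G` is immaterial: only chains allowed in `G` are subdivided.
    if h : G.graph.Adj (v 0) (v 1) then
      edge (G.old (v 0)) (G.mid ⟨(v 0, v 1), h⟩) + edge (G.mid ⟨(v 0, v 1), h⟩) (G.old (v 1))
    else 0

/-- The chain homotopy that maps the midpoint of an edge to the second half of the edge. -/
def halfEdge : Chains G.medial.V 0 →ₗ[ℝ] Chains G.medial.V 1 :=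
  Finsupp.linearCombination ℝ fun v =>
    Sum.elim (fun _ => 0) (fun e : G.EdgeType => edge (G.mid e) (G.old e.1.2)) (v 0)

theorem halfEdge_old (a : G.V) : G.halfEdge (vertex (G.old a)) = 0 := by
  simp [halfEdge, vertex, old]

theorem halfEdge_mid (e : G.EdgeType) :
    G.halfEdge (vertex (G.mid e)) = edge (G.mid e) (G.old e.1.2) := by
  simp [halfEdge, vertex, mid]

variable {G}

theorem subdivide_edge (e : G.EdgeType) :
    G.subdivide (edge e.1.1 e.1.2) =
      edge (G.old e.1.1) (G.mid e) + edge (G.mid e) (G.old e.1.2) := by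
  have h : G.graph.Adj ((![e.1.1, e.1.2] : Fin 2 → G.V) 0)
    ((![e.1.1, e.1.2] : Fin 2 → G.V) 1) := e.2
  rw [edge_of_ne (ne_of_adj e.2), subdivide, Finsupp.linearCombination_single, one_smul,
    dif_pos h]
  rfl

theorem subdivide_mem_cycles {x : Chains G.V 1} (hx : x ∈ cycles G.graph) :
    G.subdivide x ∈ cycles G.medial.graph := by
  rw [mem_cycles] at hx ⊢
  have h1 : allowed G.graph 1 ≤ (allowed G.medial.graph 1).comap G.subdivide :=
    allowed_one_le G.loopless fun a b hab => by
      rw [Submodule.mem_comap, subdivide_edge ⟨(a, b), hab⟩]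
      exact add_mem (edge_mem_allowed (adj_old_mid _)) (edge_mem_allowed (adj_mid_old _))
  have h2 : allowed G.graph 1 ≤
      LinearMap.eqLocus (boundary G.medial.V 0 ∘ₗ G.subdivide) (push G.old 0 ∘ₗ boundary G.V 0) :=
    allowed_one_le G.loopless fun a b hab => by
      rw [LinearMap.mem_eqLocus, LinearMap.comp_apply, subdivide_edge ⟨(a, b), hab⟩]
      simp only [map_add, boundary_zero_edge, LinearMap.comp_apply, map_sub, push_vertex]
      abel
  refine ⟨h1 hx.1, ?_⟩
  have := h2 hx.1
  rw [LinearMap.mem_eqLocus, LinearMap.comp_apply, LinearMap.comp_apply, hx.2, map_zero] at this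
  exact this

theorem push_collapse_subdivide {x : Chains G.V 1} (hx : x ∈ cycles G.graph) :
    push G.collapse 1 (G.subdivide x) = x := by
  have h : allowed G.graph 1 ≤
      LinearMap.eqLocus (push G.collapse 1 ∘ₗ G.subdivide) LinearMap.id :=
    allowed_one_le G.loopless fun a b hab => by
      rw [LinearMap.mem_eqLocus, LinearMap.comp_apply, subdivide_edge ⟨(a, b), hab⟩]
      simp
  exact h (mem_cycles.1 hx).1

/-- On edges of the subdivision, the composite is `id + halfEdge ∘ ∂`, and the homotopy term
vanishes on cycles. -/
theorem subdivide_push_collapse {x : Chains G.medial.V 1} (hx : x ∈ cycles G.medial.graph) :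
    G.subdivide (push G.collapse 1 x) = x := by
  have h : allowed G.medial.graph 1 ≤
      LinearMap.eqLocus (G.subdivide ∘ₗ push G.collapse 1)
        (LinearMap.id + G.halfEdge ∘ₗ boundary G.medial.V 0) :=
    allowed_one_le G.medial.loopless fun x y hxy => by
      rw [LinearMap.mem_eqLocus]
      simp only [LinearMap.comp_apply, LinearMap.add_apply, LinearMap.id_apply,
        boundary_zero_edge, map_sub, push_edge]
      obtain ⟨e, ⟨rfl, rfl⟩ | ⟨rfl, rfl⟩⟩ := medial_adj_cases hxy
      · rw [halfEdge_old, halfEdge_mid, collapse_old, collapse_mid, subdivide_edge, sub_zero]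
      · rw [halfEdge_old, halfEdge_mid, collapse_old, collapse_mid, edge_self, map_zero]
        abel
  rw [mem_cycles] at hx
  have := h hx.1
  rw [LinearMap.mem_eqLocus, LinearMap.add_apply, LinearMap.comp_apply, LinearMap.comp_apply,
    hx.2, map_zero, add_zero] at this
  exact this

/-- The triangles through the midpoints make `subdivide x` homologous to `push G.old 1 x`, which
bounds because `old` does not increase distances. The triangles require time to have passed all edge
weights. -/
theorem subdivide_mem_boundaries {s t : ℝ} (hst : s ≤ t)
    (hG : ∀ a b, G.graph.Adj a b → G.w a b ≤ t)
    {x : Chains G.V 1} (hx : x ∈ cycles G.graph) (hx' : x ∈ boundaries (G.shortestPath s)) :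
    G.subdivide x ∈ boundaries (G.medial.shortestPath t) := by
  have h : allowed G.graph 1 ≤
      (boundaries (G.medial.shortestPath t)).comap (G.subdivide - push G.old 1) :=
    allowed_one_le G.loopless fun a b hab => by
      rw [Submodule.mem_comap, LinearMap.sub_apply, subdivide_edge ⟨(a, b), hab⟩, push_edge]
      have hw := medial_w_le hG
      have hle : ∀ x y, G.medial.graph.Adj x y → G.medial.w x y ≤ t := fun x y hxy => by
        linarith [hw x y hxy, G.w_pos _ _ hab, hG _ _ hab]
      have h1 := le_shortestPath hle (adj_old_mid (G := G) ⟨(a, b), hab⟩)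
      have h2 := le_shortestPath hle (adj_mid_old (G := G) ⟨(a, b), hab⟩)
      have h3 : (G.medial.shortestPath t).Adj (G.old a) (G.old b) :=
        shortestPath_adj.2 ⟨fun h => ne_of_adj hab (Sum.inl_injective h), _,
          (Walk.of_adj hab).old, hG _ _ hab⟩
      have h4 := triangle_mem_boundaries h1 h2 h3
      convert h4 using 1
      abel
  have h1 := h (mem_cycles.1 hx).1
  rw [Submodule.mem_comap, LinearMap.sub_apply] at h1
  have h2 := (isWeakMap_old hst).push_mem_boundaries hx'
  simpa using add_mem h1 h2

theorem finrank_le_of_leftInverse {E F : Type} [AddCommGroup E] [Module ℝ E] [AddCommGroup F]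
    [Module ℝ F] [FiniteDimensional ℝ F] (φ : E →ₗ[ℝ] F) (ψ : F →ₗ[ℝ] E) {X : Submodule ℝ E}
    {Y : Submodule ℝ F} (h : ∀ x ∈ X, φ x ∈ Y) (h' : ∀ x ∈ X, ψ (φ x) = x) :
    Module.finrank ℝ X ≤ Module.finrank ℝ Y := by
  refine LinearMap.finrank_le_finrank_of_injective (f := φ.restrict h) fun x y hxy => ?_
  have h1 : φ x = φ y := congrArg Subtype.val hxy
  exact Subtype.ext (by rw [← h' x x.2, h1, h' y y.2])

theorem finrank_cycles_medial (G : WDigraph) :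
    Module.finrank ℝ (cycles G.medial.graph) = Module.finrank ℝ (cycles G.graph) := by
  exact le_antisymm
    (finrank_le_of_leftInverse (push G.collapse 1) G.subdivide
      (fun _ => isWeakMap_collapse_graph.push_mem_cycles) fun _ => subdivide_push_collapse)
    (finrank_le_of_leftInverse G.subdivide (push G.collapse 1)
      (fun _ => subdivide_mem_cycles) fun _ => push_collapse_subdivide)

/-- Pushing along `collapse` is injective on cycles and delays the filtration by at most a `lag`,
hence by at most `W`. -/
theorem nullRank_medial_le {W : ℝ} (hW0 : 0 ≤ W) (hW : ∀ a b, G.graph.Adj a b → G.w a b ≤ W)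
    (t : ℝ) : G.medial.nullRank t ≤ G.nullRank (t + W) := by
  exact finrank_le_of_leftInverse (push G.collapse 1) G.subdivide
    (fun x hx => ⟨isWeakMap_collapse_graph.push_mem_cycles hx.1,
      (isWeakMap_collapse hW0 hW t).push_mem_boundaries hx.2⟩)
    fun x hx => subdivide_push_collapse hx.1

theorem nullRank_le_medial {W : ℝ} (hW0 : 0 ≤ W) (hW : ∀ a b, G.graph.Adj a b → G.w a b ≤ W)
    (t : ℝ) : G.nullRank t ≤ G.medial.nullRank (t + W) := by
  -- For `t < 0` the time `t + W` may precede the weights, but then there is nothing to bound.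
  rcases lt_or_ge t 0 with ht | ht
  · rw [nullRank_of_neg ht]
    exact Nat.zero_le _
  exact finrank_le_of_leftInverse G.subdivide (push G.collapse 1)
    (fun x hx => ⟨subdivide_mem_cycles hx.1, subdivide_mem_boundaries (s := t) (by linarith)
      (fun a b hab => by linarith [hW a b hab]) hx.1 hx.2⟩)
    fun x hx => push_collapse_subdivide hx.1

end WDigraph

/-! ### Barcodes of the two pipelines -/

section Subquotient

variable {E : Type} [AddCommGroup E] [Module ℝ E]
  {Z B : ℝ → Submodule ℝ E} (hZ : Monotone Z) (hB : Monotone B)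

theorem finrank_subquotient_add [FiniteDimensional ℝ E] {t : ℝ} (h : B t ≤ Z t) :
    Module.finrank ℝ ((subquotient Z B hZ hB).obj t) + Module.finrank ℝ (B t) =
      Module.finrank ℝ (Z t) := by
  change Module.finrank ℝ (Z t ⧸ (B t).submoduleOf (Z t)) + _ = _
  rw [← Submodule.finrank_quotient_add_finrank ((B t).submoduleOf (Z t)),
    (Submodule.submoduleOfEquivOfLe h).finrank_eq]

theorem finrank_subquotient_le [FiniteDimensional ℝ E] (t : ℝ) :
    Module.finrank ℝ ((subquotient Z B hZ hB).obj t) ≤ Module.finrank ℝ (Z t) :=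
  Submodule.finrank_quotient_le ((B t).submoduleOf (Z t))

theorem surjective_subquotient_map {s t : ℝ} (hst : s ≤ t) (h : Z t ≤ Z s ⊔ B t) :
    Function.Surjective ((subquotient Z B hZ hB).map (homOfLE hst)).hom := by
  intro x
  obtain ⟨⟨x, hx⟩, rfl⟩ := Submodule.Quotient.mk_surjective _ x
  obtain ⟨y, hy, z, hz, rfl⟩ := Submodule.mem_sup.1 (h hx)
  refine ⟨Submodule.Quotient.mk ⟨y, hy⟩, (Submodule.Quotient.eq _).2 ?_⟩
  change y - (y + z) ∈ B t
  rw [sub_add_cancel_left]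
  exact neg_mem hz

end Subquotient

section Pipelines

variable {G : WDigraph} {K : ℝ → Digraph G.V} (hK : Monotone K) {T : ℝ}

theorem exists_isBarcode_persistentH1 {V : Type} [Finite V] {K L : ℝ → Digraph V}
    (hK : Monotone K) (hL : Monotone L) : ∃ C, IsBarcode (persistentH1 K L hK hL) C :=
  exists_isBarcode_subquotient _ _

/-- By `cycles_shortestPath` the cycles are `Z + B`, with `Z` the cycles of `G`, so `dim ((Z + B) /
B) = dim Z - dim (Z ⊓ B)`. -/
theorem finrank_persistentH1_add {t : ℝ} (hG : G.graph ≤ G.shortestPath t)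
    (hKt : K t = G.shortestPath t) :
    Module.finrank ℝ ((persistentH1 G.shortestPath K G.shortestPath_mono hK).obj t) +
      G.nullRank t = Module.finrank ℝ (cycles G.graph) := by
  have h0 : boundaries (G.shortestPath t) ≤ cycles (K t) := by
    rw [hKt]
    exact boundaries_le_cycles _
  have h1 := finrank_subquotient_add (fun _ _ h => cycles_mono (hK h))
    (fun _ _ h => boundaries_mono (G.shortestPath_mono h)) h0
  change Module.finrank ℝ ((persistentH1 G.shortestPath K G.shortestPath_mono hK).obj t) +
    Module.finrank ℝ (boundaries (G.shortestPath t)) = Module.finrank ℝ (cycles (K t)) at h1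
  rw [hKt] at h1
  have h2 := Submodule.finrank_sup_add_finrank_inf_eq (cycles G.graph)
    (boundaries (G.shortestPath t))
  rw [← WDigraph.cycles_shortestPath hG] at h2
  rw [WDigraph.nullRank]
  omega

theorem surjective_persistentH1_map {s t : ℝ} (hst : s ≤ t) (hG : G.graph ≤ G.shortestPath s)
    (hKs : G.shortestPath s ≤ K s) (hKt : K t = G.shortestPath t) :
    Function.Surjective ((persistentH1 G.shortestPath K G.shortestPath_mono hK).map
      (homOfLE hst)).hom := by
  refine surjective_subquotient_map _ _ hst ?_
  change cycles (K t) ≤ cycles (K s) ⊔ boundaries (G.shortestPath t)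
  rw [hKt, WDigraph.cycles_shortestPath (hG.trans (G.shortestPath_mono hst))]
  exact sup_le_sup_right (cycles_mono (hG.trans hKs)) _

/-- Both pipelines at once: `K` has to be empty at negative times and equal to `G^t` from `T` on.
What it does in between affects only bars inside `[0, T]` and births. -/
theorem bottleneckDist_persistentH1_le (hT : 0 ≤ T)
    (hG : ∀ a b, G.graph.Adj a b → G.w a b ≤ T)
    (hneg : ∀ t < 0, ∀ a b, ¬ (K t).Adj a b) (hKT : ∀ t, T ≤ t → K t = G.shortestPath t)
    {h : ℝ → ℕ} (hh : Monotone h) {δ : ℝ} (hδ : 0 ≤ δ)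
    (h1 : ∀ t, h (t - δ) ≤ G.nullRank t) (h2 : ∀ t, G.nullRank t ≤ h (t + δ))
    {C : Barcode} (hC : IsBarcode (persistentH1 G.shortestPath K G.shortestPath_mono hK) C) :
    bottleneckDist C (quotientBarcode (Module.finrank ℝ (cycles G.graph)) h hh) ≤
      ENNReal.ofReal (T + δ) := by
  have hGt : ∀ t, T ≤ t → G.graph ≤ G.shortestPath t := fun t ht =>
    WDigraph.le_shortestPath fun a b hab => (hG a b hab).trans ht
  refine bottleneckDist_quotientBarcode_le (k := G.nullRank) hh hT hδ ?_ ?_ ?_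
    (fun t _ => h1 t) (fun t _ => h2 t)
  · intro i t ht
    by_contra hc
    have h3 := hC.finrank_eq t
    have h4 : Module.finrank ℝ
        ((persistentH1 G.shortestPath K G.shortestPath_mono hK).obj t) = 0 := by
      have h5 : cycles (K t) = ⊥ := cycles_eq_bot (hneg t (not_le.1 hc))
      refine Nat.le_zero.1 ((finrank_subquotient_le _ _ t).trans ?_)
      change Module.finrank ℝ (cycles (K t)) ≤ 0
      rw [h5, finrank_bot]
    rw [h4] at h3
    have h6 := (Set.ncard_eq_zero (Set.toFinite _)).1 h3.symm
    exact absurd (show i ∈ {i | t ∈ (C.bar i).carrier} from ht) (by simp [h6])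
  · intro i t ht hi
    exact hC.mem_of_surjective ht
      (surjective_persistentH1_map hK ht (hGt T le_rfl) (hKT T le_rfl).ge (hKT t ht)) hi
  · intro t ht
    rw [← hC.finrank_eq]
    exact finrank_persistentH1_add hK (hGt t ht) (hKT t ht)

theorem grounded_eq {t : ℝ} (hG : G.graph ≤ G.shortestPath t) :
    G.grounded t = G.shortestPath t := by
  refine le_antisymm (fun a b h => ?_) fun a b h => Or.inr h
  exact h.elim (fun h => hG h.2) id

theorem bottleneckDist_standardPH_le (hT : 0 ≤ T)
    (hG : ∀ a b, G.graph.Adj a b → G.w a b ≤ T)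
    {h : ℝ → ℕ} (hh : Monotone h) {δ : ℝ} (hδ : 0 ≤ δ)
    (h1 : ∀ t, h (t - δ) ≤ G.nullRank t) (h2 : ∀ t, G.nullRank t ≤ h (t + δ))
    {C : Barcode} (hC : IsBarcode (standardPH G) C) :
    bottleneckDist C (quotientBarcode (Module.finrank ℝ (cycles G.graph)) h hh) ≤
      ENNReal.ofReal (T + δ) :=
  bottleneckDist_persistentH1_le _ hT hG (fun _ => WDigraph.not_shortestPath_adj_of_neg)
    (fun _ _ => rfl) hh hδ h1 h2 hC

theorem bottleneckDist_groundedPH_le (hT : 0 ≤ T)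
    (hG : ∀ a b, G.graph.Adj a b → G.w a b ≤ T)
    {h : ℝ → ℕ} (hh : Monotone h) {δ : ℝ} (hδ : 0 ≤ δ)
    (h1 : ∀ t, h (t - δ) ≤ G.nullRank t) (h2 : ∀ t, G.nullRank t ≤ h (t + δ))
    {C : Barcode} (hC : IsBarcode (groundedPH G) C) :
    bottleneckDist C (quotientBarcode (Module.finrank ℝ (cycles G.graph)) h hh) ≤
      ENNReal.ofReal (T + δ) := by
  refine bottleneckDist_persistentH1_le _ hT hG (fun t ht a b hab => ?_) (fun t ht => ?_)
    hh hδ h1 h2 hC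
  · exact hab.elim (fun h => absurd h.1 (not_le.2 ht))
      (WDigraph.not_shortestPath_adj_of_neg ht a b)
  · exact grounded_eq (WDigraph.le_shortestPath fun a b hab => (hG a b hab).trans ht)

end Pipelines

/-! ### The limit -/

namespace WDigraph

theorem exists_w_le (G : WDigraph) :
    ∃ W, 0 ≤ W ∧ ∀ a b, G.graph.Adj a b → G.w a b ≤ W := by
  obtain ⟨W, hW⟩ := (Set.finite_range fun p : G.V × G.V => G.w p.1 p.2).bddAbove
  exact ⟨max W 0, le_max_right _ _, fun a b _ =>
    (hW ⟨(a, b), rfl⟩).trans (le_max_left _ _)⟩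

variable {G : WDigraph} {W : ℝ}

theorem iteratedMedial_w_le (hW : ∀ a b, G.graph.Adj a b → G.w a b ≤ W) :
    ∀ (n : ℕ) (a b : (G.iteratedMedial n).V), (G.iteratedMedial n).graph.Adj a b →
      (G.iteratedMedial n).w a b ≤ W / 2 ^ n
  | 0, a, b, hab => by
    rw [pow_zero, div_one]
    exact hW a b hab
  | n + 1, a, b, hab => by
    have := medial_w_le (iteratedMedial_w_le hW n) a b hab
    rwa [div_div, ← pow_succ] at this

theorem finrank_cycles_iteratedMedial (G : WDigraph) : ∀ n : ℕ,
    Module.finrank ℝ (cycles (G.iteratedMedial n).graph) = Module.finrank ℝ (cycles G.graph)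
  | 0 => rfl
  | n + 1 => (finrank_cycles_medial _).trans (finrank_cycles_iteratedMedial G n)

/-- The step from `n` to `n + 1` costs a shift by `W / 2^n`, which is exactly the difference of `2 *
(W / 2^n)` and `2 * (W / 2^(n+1))`. -/
theorem monotone_nullRank_sub (hW0 : 0 ≤ W) (hW : ∀ a b, G.graph.Adj a b → G.w a b ≤ W)
    (t : ℝ) : Monotone fun n => (G.iteratedMedial n).nullRank (t - 2 * (W / 2 ^ n)) := by
  refine monotone_nat_of_le_succ fun n => ?_
  have h := nullRank_le_medial (by positivity) (iteratedMedial_w_le hW n)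
    (t - 2 * (W / 2 ^ n))
  refine h.trans_eq ?_
  change (G.iteratedMedial (n + 1)).nullRank _ = _
  congr 1
  rw [pow_succ]
  field_simp
  ring

theorem antitone_nullRank_add (hW0 : 0 ≤ W) (hW : ∀ a b, G.graph.Adj a b → G.w a b ≤ W)
    (t : ℝ) : Antitone fun n => (G.iteratedMedial n).nullRank (t + 2 * (W / 2 ^ n)) := by
  refine antitone_nat_of_succ_le fun n => ?_
  have h := nullRank_medial_le (by positivity) (iteratedMedial_w_le hW n)
    (t + 2 * (W / 2 ^ (n + 1)))
  refine h.trans_eq ?_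
  congr 1
  rw [pow_succ]
  field_simp
  ring

/-- The limit of the functions `nullRank` of the iterated medial subdivisions of `G`. -/
def limitRank (G : WDigraph) (W t : ℝ) : ℕ :=
  ⨆ n, (G.iteratedMedial n).nullRank (t - 2 * (W / 2 ^ n))

theorem bddAbove_nullRank (t : ℕ → ℝ) :
    BddAbove (Set.range fun n => (G.iteratedMedial n).nullRank (t n)) := by
  refine ⟨Module.finrank ℝ (cycles G.graph), ?_⟩
  rintro _ ⟨n, rfl⟩
  exact (nullRank_le _).trans_eq (finrank_cycles_iteratedMedial G n)

theorem limitRank_mono : Monotone (G.limitRank W) := fun _ _ hst =>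
  ciSup_mono (bddAbove_nullRank _) fun _ => nullRank_mono (by linarith)

theorem limitRank_sub_le (hW0 : 0 ≤ W) (hW : ∀ a b, G.graph.Adj a b → G.w a b ≤ W) (n : ℕ)
    (t : ℝ) : G.limitRank W (t - 2 * (W / 2 ^ n)) ≤ (G.iteratedMedial n).nullRank t := by
  refine ciSup_le fun m => ?_
  have hm : 0 ≤ W / 2 ^ m := by positivity
  have hn : 0 ≤ W / 2 ^ n := by positivity
  -- Terms with `m ≤ n` are bounded by the increasing lower sequence, those with `m ≥ n` by passing
  -- to the decreasing upper one.
  rcases le_total m n with hmn | hmn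
  · exact (monotone_nullRank_sub hW0 hW (t - 2 * (W / 2 ^ n)) hmn).trans
      (nullRank_mono (by linarith))
  · refine (nullRank_mono ?_).trans
      ((antitone_nullRank_add hW0 hW (t - 2 * (W / 2 ^ n)) hmn).trans (nullRank_mono ?_)) <;>
    linarith

theorem le_limitRank_add (n : ℕ) (t : ℝ) :
    (G.iteratedMedial n).nullRank t ≤ G.limitRank W (t + 2 * (W / 2 ^ n)) := by
  refine le_trans (nullRank_mono ?_) (le_ciSup (bddAbove_nullRank _) n)
  linarith

end WDigraph

theorem tendsto_bottleneckDist {M : ℕ → PersVec} {L : Barcode} {W : ℝ}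
    (hM : ∀ n C, IsBarcode (M n) C →
      bottleneckDist C L ≤ ENNReal.ofReal (W / 2 ^ n + 2 * (W / 2 ^ n)))
    (hM' : ∀ n, ∃ C, IsBarcode (M n) C) : BarcodesTendsto M L := by
  refine ⟨hM', fun B hB => ?_⟩
  have h1 : Tendsto (fun n : ℕ => W / 2 ^ n) atTop (𝓝 0) :=
    tendsto_const_nhds.div_atTop (tendsto_pow_atTop_atTop_of_one_lt one_lt_two)
  have h2 : Tendsto (fun n : ℕ => ENNReal.ofReal (W / 2 ^ n + 2 * (W / 2 ^ n))) atTop (𝓝 0) := by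
    have := ENNReal.tendsto_ofReal (h1.add (h1.const_mul 2))
    simpa using this
  exact tendsto_of_tendsto_of_tendsto_of_le_of_le tendsto_const_nhds h2 (fun _ => zero_le)
    fun n => hM n _ (hB n)

end

end GrPPH

theorem mainTheorem11 (G : GrPPH.WDigraph) :
    ∃ L : GrPPH.Barcode,
      GrPPH.BarcodesTendsto (fun n => GrPPH.groundedPH (G.iteratedMedial n)) L ∧
      GrPPH.BarcodesTendsto (fun n => GrPPH.standardPH (G.iteratedMedial n)) L := by
  obtain ⟨W, hW0, hW⟩ := G.exists_w_le
  have hpos : ∀ n : ℕ, 0 ≤ W / 2 ^ n := fun n => by positivity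
  refine ⟨GrPPH.quotientBarcode (Module.finrank ℝ (GrPPH.cycles G.graph)) (G.limitRank W)
    GrPPH.WDigraph.limitRank_mono, GrPPH.tendsto_bottleneckDist (W := W) (fun n C hC => ?_)
    fun n => GrPPH.exists_isBarcode_persistentH1 _ _,
    GrPPH.tendsto_bottleneckDist (W := W) (fun n C hC => ?_)
    fun n => GrPPH.exists_isBarcode_persistentH1 _ _⟩
  -- The number of bars of the limit is the cycle rank, which all subdivisions share; the bounds at
  -- level `n` are stated with that of `G_n`.
  all_goals rw [← G.finrank_cycles_iteratedMedial n]
  · exact GrPPH.bottleneckDist_groundedPH_le (hpos n) (GrPPH.WDigraph.iteratedMedial_w_le hW n) _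
      (mul_nonneg zero_le_two (hpos n)) (GrPPH.WDigraph.limitRank_sub_le hW0 hW n)
      (GrPPH.WDigraph.le_limitRank_add n) hC
  · exact GrPPH.bottleneckDist_standardPH_le (hpos n) (GrPPH.WDigraph.iteratedMedial_w_le hW n) _
      (mul_nonneg zero_le_two (hpos n)) (GrPPH.WDigraph.limitRank_sub_le hW0 hW n)
      (GrPPH.WDigraph.le_limitRank_add n) hC
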